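/- Let $d\ge 1$. For a path $X:[0,1]\to\mathbb R^d$ of bounded variation and a word $w=(i_1,\dots,i_k)\in\{1,\dots,d\}^k$ let $$S^w(X)=\int\cdots\int_{0\le u_1<\cdots<u_k\le 1}dX^{i_1}_{u_1}\cdots dX^{i_k}_{u_k}$$ (Lebesgue–Stieltjes integrals, with value $1$ for the empty word), and let $S^m(X)=(S^w(X))_{|w|\le m}\in\mathbb R^{s_d(m)}$, $s_d(m)=\sum_{k=0}^m d^k$, be the signature truncated at order $m$. Norms and scalar products are Euclidean. Let $(X,Y)$ be a random pair, where $X$ is a random path of bounded variation in $\mathbb R^d$ and $Y$ is a real random variable. Assume that there are $m\in\mathbb N$ and $\beta\in\mathbb R^{s_d(m)}$ with $\mathbb E[Y\mid X]=\langle\beta,S^m(X)\rangle$ almost surely, let $m^\ast$ be the smallest such $m$, and let $\beta^\ast_{m^\ast}\in\mathbb R^{s_d(m^\ast)}$ satisfy $\mathbb E[Y\mid X]=\langle\beta^\ast_{m^\ast},S^{m^\ast}(X)\rangle$ almost surely. Fix $\alpha>0$ and assume: - $(H_\alpha)$ $\|\beta^\ast_{m^\ast}\|\le\alpha$; - $(H_K)$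 there are $K_Y,K_X>0$ such that almost surely $|Y|\le K_Y$ and the total variation of $X$ satisfies $\|X\|_{TV}\le K_X$. Let $(X_1,Y_1),(X_2,Y_2),\dots$ be i.i.d. copies of $(X,Y)$, jointly independent of $(X,Y)$. For $n\ge1$ and $m\in\mathbb N$ let $$\widehat{\mathcal R}_{m,n}(\beta)=\frac1n\sum_{i=1}^n\big(Y_i-\langle\beta,S^m(X_i)\rangle\big)^2,\qquad \widehat L_n(m)=\min_{\|\beta\|\le\alpha}\widehat{\mathcal R}_{m,n}(\beta),$$ the minimum being over $\beta\in\mathbb R^{s_d(m)}$, and let $\widehat\beta_m$ be any measurable function of the sample $(X_1,Y_1),\dots,(X_n,Y_n)$ with $\|\widehat\beta_m\|\le\alpha$ at which this minimum is attained. Let $K_{\rm pen}>0$, $0<\rho<\frac12$, $\mathrm{pen}_n(m)=K_{\rm pen}\,n^{-\rho}\sqrt{s_d(m)}$, and let $\widehat m$ be the smallest minimizer over $m\in\mathbb N$ of $\widehat L_n(m)+\mathrm{pen}_n(m)$. Then, as $n\to\infty$, $$\mathbb E\Big[\big(\langle\widehat\beta_{\widehat m},S^{\widehat m}(X)\rangle-\langle\beta^\ast_{m^\ast},S^{m^\ast}(X)\rangle\big)^2\Big]=\mathcal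 O\big(n^{-1/2}\big)$$ (the expectation, over the sample and $(X,Y)$, being that of an integrable random variable). -/

import Mathlib

open MeasureTheory ProbabilityTheory Filter
open scoped Asymptotics unitInterval

noncomputable section

namespace SigReg

/-- Paths `[0,1] → ℝ^d` of bounded variation (for the Euclidean norm on `ℝ^d`). -/
def BVPath (d : ℕ) : Type :=
  {X : I → EuclideanSpace ℝ (Fin d) // BoundedVariationOn X Set.univ}

namespace BVPath

variable {d : ℕ}

/-- The path space carries the σ-algebra generated by the evaluations `X ↦ X_t`, so that a
measurable map into it is a stochastic process on `[0,1]` with paths of bounded variation. -/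
instance : MeasurableSpace (BVPath d) := Subtype.instMeasurableSpace

/-- Total variation `‖X‖_TV`. -/
def tv (X : BVPath d) : ENNReal := eVariationOn X.1 Set.univ

/-- The `i`-th coordinate of a path. -/
def coord (X : BVPath d) (i : Fin d) : I → ℝ := fun t => X.1 t i

theorem coord_boundedVariationOn (X : BVPath d) (i : Fin d) :
    BoundedVariationOn (X.coord i) Set.univ := by
  have h : LipschitzWith 1 (fun v : EuclideanSpace ℝ (Fin d) => v i) :=
    LipschitzWith.of_dist_le_mul fun v w => by
      simpa [dist_eq_norm] using PiLp.norm_apply_le (v - w) i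
  exact h.comp_boundedVariationOn X.2

/-- The Lebesgue–Stieltjes (signed) measure `dX^i` on `[0,1]`. Its mass on `[a,b]` is
`X^i_{b+} - X^i_{a-}`, with the conventions `X_{0-} = X_0` and `X_{1+} = X_1`. -/
def stieltjes (X : BVPath d) (i : Fin d) : VectorMeasure I ℝ :=
  (X.coord_boundedVariationOn i).vectorMeasure

/-- The iterated integral `∫ ⋯ ∫ dX^{i_1}_{u_1} ⋯ dX^{i_k}_{u_k}` over `u_1 < ⋯ < u_k`, `u_k ∈ s`,
for a word `w = (i_1, …, i_k)`; the empty word gives `1`. -/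
def iterInt (X : BVPath d) : (k : ℕ) → (Fin k → Fin d) → Set I → ℝ
  | 0, _, _ => 1
  | k + 1, w, s =>
      ∫ᵛ u in s, iterInt X k (Fin.init w) (Set.Iio u) ∂•(X.stieltjes (w (Fin.last k)))

/-- The signature coefficient of `X` along the word `w`: the iterated integral over
`0 ≤ u_1 < ⋯ < u_k ≤ 1`. -/
def sigCoeff (X : BVPath d) {k : ℕ} (w : Fin k → Fin d) : ℝ :=
  X.iterInt k w Set.univ

end BVPath

/-- Words of length at most `m` in the letters `1, …, d`: the indices of the coefficients of the
signature truncated at order `m`. -/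
abbrev Word (d m : ℕ) : Type := (k : Fin (m + 1)) × (Fin k → Fin d)

/-- `s_d(m) = 1 + d + ⋯ + d^m`. -/
def sigDim (d m : ℕ) : ℕ := ∑ k ∈ Finset.range (m + 1), d ^ k

/-- The Euclidean space `ℝ^{s_d(m)}`, with coordinates indexed by the words of length at
most `m`. -/
abbrev Coeff (d m : ℕ) : Type := EuclideanSpace ℝ (Word d m)

variable {d : ℕ}

/-- The signature truncated at order `m`. -/
def truncSig (m : ℕ) (X : BVPath d) : Coeff d m :=
  WithLp.toLp 2 fun w => X.sigCoeff w.2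

/-- A sample of `n` observations (path, response). -/
abbrev Sample (d n : ℕ) : Type := Fin n → BVPath d × ℝ

/-- The empirical risk `(1/n) ∑_i (Y_i - ⟨β, S^m(X_i)⟩)²`. -/
def empRisk {n : ℕ} (D : Sample d n) (m : ℕ) (β : Coeff d m) : ℝ :=
  (1 / (n : ℝ)) * ∑ i, ((D i).2 - inner ℝ β (truncSig m (D i).1)) ^ 2

/-- The minimal empirical risk at order `m` over the ball of radius `α`. -/
def minEmpRisk (α : ℝ) {n : ℕ} (D : Sample d n) (m : ℕ) : ℝ :=
  ⨅ β : Metric.closedBall (0 : Coeff d m) α, empRisk D m β.1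

/-- The penalty `K_pen n^{-ρ} √(s_d(m))`. -/
def pen (d : ℕ) (Kpen ρ : ℝ) (n m : ℕ) : ℝ :=
  Kpen * (n : ℝ) ^ (-ρ) * √(sigDim d m : ℝ)

/-- The estimator of the truncation order: the smallest minimizer over `m ∈ ℕ` of the penalized
minimal empirical risk. -/
def mHat (α Kpen ρ : ℝ) {n : ℕ} (D : Sample d n) : ℕ :=
  sInf {m | ∀ m' : ℕ,
    minEmpRisk α D m + pen d Kpen ρ n m ≤ minEmpRisk α D m' + pen d Kpen ρ n m'}

/-- `b` is a (measurable) choice of the empirical risk minimizer at order `m`, for samples of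
size `n`, over the ball of radius `α`. -/
structure IsERM (α : ℝ) {n m : ℕ} (b : Sample d n → Coeff d m) : Prop where
  measurable : Measurable b
  norm_le : ∀ D, ‖b D‖ ≤ α
  isMin : ∀ D, ∀ β : Coeff d m, ‖β‖ ≤ α → empRisk D m (b D) ≤ empRisk D m β

/-- The regression function of `Y` on `X` is the linear form `β` on the signature of `X`
truncated at order `m`: `E[Y | X] = ⟨β, S^m(X)⟩` almost surely. -/
def IsRegression {Ω : Type*} [MeasurableSpace Ω] (P : Measure Ω) (X : Ω → BVPath d) (Y : Ω → ℝ)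
    (m : ℕ) (β : Coeff d m) : Prop :=
  P[Y | MeasurableSpace.comap X inferInstance] =ᵐ[P] fun ω => inner ℝ β (truncSig m (X ω))

end SigReg

end

/-!
Integrating against the variation measures of the coordinates of a path bounds its iterated
integrals of order `k` by `C ^ k / (k - 1)!`, so the truncated signatures of paths of variation at
most `K` are bounded by a constant which does not depend on the truncation order.

After extension of the coefficients by zero to a common order `M`, the difference of the risks of
two predictors is a linear function of `γ` and `γ ⊗ γ`, where `γ` is the difference of the
coefficients. Hence empirical and population risk gaps to `βstar` differ on the ball of radius `α`
by at most a combination of the deviations of two sample means in Hilbert spaces. Their expectation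
is at most `C / √n` with `C` independent of `M`: the variance of a mean of independent vectors does
not see the dimension.

By compactness the excess risk is bounded away from zero at the orders below `mstar`. Once the
penalty at `mstar` is small compared to this gap, the selected estimator has excess risk at most
twice the fluctuation of order `M` for every `M` beyond the selected order. As that order is random
and unbounded, the bound in expectation is obtained by Fatou's lemma as `M → ∞`. Independence of
the new pair identifies the mean square prediction error with the expected excess risk.
-/

namespace SigReg

section StieltjesVariation

open Set Topology

theorem isBot_zero_unitInterval : IsBot (0 : I) := fun x => x.2.1

theorem singleton_zero_union_Ioc_unitInterval : ({0} : Set I) ∪ Ioc 0 1 = univ := by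
  rw [singleton_union, Ioc_insert_left zero_le_one]
  exact eq_univ_of_forall fun x => ⟨x.2.1, x.2.2⟩

theorem vectorMeasure_unitInterval_ext {μ ν : VectorMeasure I ℝ} (h0 : μ {0} = ν {0})
    (hIoc : ∀ a b, a ≤ b → μ (Ioc a b) = ν (Ioc a b)) : μ = ν := by
  refine VectorMeasure.ext_of_generateFrom {s | ∃ a b, a ≤ b ∧ s = Ioc a b} ?_ ?_ ?_ ?_
  · rintro _ ⟨a, b, hab, rfl⟩
    exact hIoc a b hab
  · rw [BorelSpace.measurable_eq (α := I)]
    convert! borel_eq_generateFrom_Ioc_le I using 2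
    grind only
  · rintro _ ⟨a, b, -, rfl⟩ _ ⟨a', b', -, rfl⟩ ⟨x, hx⟩
    rw [Ioc_inter_Ioc] at hx ⊢
    exact ⟨_, _, (hx.1.trans_le hx.2).le, rfl⟩
  · have hdisj : Disjoint ({0} : Set I) (Ioc 0 1) := by simp
    rw [← singleton_zero_union_Ioc_unitInterval,
      VectorMeasure.of_union hdisj (measurableSet_singleton _) measurableSet_Ioc,
      VectorMeasure.of_union hdisj (measurableSet_singleton _) measurableSet_Ioc,
      h0, hIoc 0 1 zero_le_one]

theorem stieltjesFunction_measure_singleton_zero (g : StieltjesFunction I) :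
    g.measure {0} = 0 := by
  rw [← botSet_eq_singleton_of_isBot isBot_zero_unitInterval, g.measure_botSet]

theorem stieltjesFunction_measure_univ (g : StieltjesFunction I) :
    g.measure univ = ENNReal.ofReal (g 1 - g 0) := by
  rw [← singleton_zero_union_Ioc_unitInterval, measure_union (by simp) measurableSet_Ioc,
    stieltjesFunction_measure_singleton_zero, g.measure_Ioc, zero_add]

theorem toSignedMeasure_stieltjesFunction_Ioc (g : StieltjesFunction I) {a b : I} (hab : a ≤ b) :
    g.measure.toSignedMeasure (Ioc a b) = g b - g a := by
  rw [Measure.toSignedMeasure_apply_measurable measurableSet_Ioc, Measure.real, g.measure_Ioc,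
    ENNReal.toReal_ofReal (sub_nonneg.2 (g.mono hab))]

variable {f : I → ℝ}

/-- The negative part of the Jordan decomposition of `f.rightLim`: the variation of `f.rightLim`
on `[0, x]` minus `f.rightLim x`, as a right-continuous monotone function of `x`. -/
noncomputable def variationSubRightLim (hf : BoundedVariationOn f univ) : StieltjesFunction I where
  toFun x := hf.stieltjesFunctionRightLim 0 x - f.rightLim x
  mono' x y hxy := variationOnFromTo.sub_self_monotoneOn
    hf.rightLim.locallyBoundedVariationOn (mem_univ 0) (mem_univ x) (mem_univ y) hxy
  right_continuous' x := ((hf.stieltjesFunctionRightLim 0).right_continuous x).sub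
    hf.continuousWithinAt_rightLim

theorem variationSubRightLim_apply (hf : BoundedVariationOn f univ) (x : I) :
    variationSubRightLim hf x = hf.stieltjesFunctionRightLim 0 x - f.rightLim x := rfl

theorem vectorMeasure_eq_toSignedMeasure_sub_add_dirac (hf : BoundedVariationOn f univ) :
    hf.vectorMeasure = (hf.stieltjesFunctionRightLim 0).measure.toSignedMeasure -
      (variationSubRightLim hf).measure.toSignedMeasure +
      VectorMeasure.dirac 0 (f.rightLim 0 - f 0) := by
  refine vectorMeasure_unitInterval_ext ?_ fun a b hab => ?_
  · simp only [_root_.add_apply, _root_.sub_apply, hf.vectorMeasure_singleton,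
      Measure.toSignedMeasure_apply_measurable (measurableSet_singleton _), Measure.real,
      stieltjesFunction_measure_singleton_zero, leftLim_eq_of_isBot isBot_zero_unitInterval,
      VectorMeasure.dirac_apply_of_mem (measurableSet_singleton _) (mem_singleton _)]
    simp
  · have h0 : (0 : I) ∉ Ioc a b := fun h => h.1.not_ge (isBot_zero_unitInterval a)
    simp only [_root_.add_apply, _root_.sub_apply, hf.vectorMeasure_Ioc hab,
      toSignedMeasure_stieltjesFunction_Ioc _ hab, variationSubRightLim_apply,
      VectorMeasure.dirac_apply_of_notMem h0]
    ring

theorem ofReal_stieltjesFunctionRightLim_sub_le (hf : BoundedVariationOn f univ) :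
    ENNReal.ofReal (hf.stieltjesFunctionRightLim 0 1 - hf.stieltjesFunctionRightLim 0 0) ≤
      eVariationOn f univ := by
  simp only [BoundedVariationOn.stieltjesFunctionRightLim_apply, variationOnFromTo.self, sub_zero,
    variationOnFromTo.eq_of_le _ _ (isBot_zero_unitInterval 1)]
  exact ENNReal.ofReal_toReal_le.trans <| (eVariationOn.mono _ (subset_univ _)).trans <|
    eVariationOn.eVariationOn_rightLim_le isOpen_univ

theorem enorm_rightLim_sub_le (hf : BoundedVariationOn f univ) :
    ‖f.rightLim 0 - f 0‖ₑ ≤ eVariationOn f univ := by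
  have : (𝓝[>] (0 : I)).NeBot := nhdsGT_neBot_of_exists_gt ⟨1, by simp⟩
  have hlim := ((hf.tendsto_rightLim 0).sub_const (f 0)).enorm
  refine le_of_tendsto hlim (Eventually.of_forall fun x => ?_)
  rw [← edist_eq_enorm_sub]
  exact eVariationOn.edist_le _ (mem_univ _) (mem_univ _)

theorem variation_vectorMeasure_univ_le (hf : BoundedVariationOn f univ) :
    hf.vectorMeasure.variation univ ≤ 4 * eVariationOn f univ := by
  have hV := ofReal_stieltjesFunctionRightLim_sub_le hf
  have hG : ENNReal.ofReal (variationSubRightLim hf 1 - variationSubRightLim hf 0) ≤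
      2 * eVariationOn f univ := by
    have hdiff : ENNReal.ofReal (f.rightLim 0 - f.rightLim 1) ≤ eVariationOn f univ := by
      refine (ENNReal.ofReal_le_ofReal (le_abs_self _)).trans ?_
      rw [← Real.enorm_eq_ofReal_abs, ← edist_eq_enorm_sub]
      exact (eVariationOn.edist_le _ (mem_univ _) (mem_univ _)).trans
        (eVariationOn.eVariationOn_rightLim_le isOpen_univ)
    rw [variationSubRightLim_apply, variationSubRightLim_apply, sub_sub_sub_comm, two_mul,
      sub_eq_add_neg _ (f.rightLim 1 - _), neg_sub]
    exact ENNReal.ofReal_add_le.trans (add_le_add hV hdiff)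
  rw [vectorMeasure_eq_toSignedMeasure_sub_add_dirac]
  calc _ ≤ _ := VectorMeasure.variation_add_le univ
    _ ≤ _ := add_le_add_left (VectorMeasure.variation_sub_le univ) _
    _ ≤ eVariationOn f univ + 2 * eVariationOn f univ + eVariationOn f univ := by
        rw [Measure.add_apply, Measure.variation_toSignedMeasure,
          Measure.variation_toSignedMeasure, stieltjesFunction_measure_univ,
          stieltjesFunction_measure_univ, VectorMeasure.variation_dirac]
        refine add_le_add (add_le_add hV hG) ?_
        simpa using enorm_rightLim_sub_le hf
    _ = 4 * eVariationOn f univ := by ring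

end StieltjesVariation

section SimplexMass

open Set

variable {T : Type*} [LinearOrder T] [MeasurableSpace T]

/-- The mass `μ^k {u_1 < ⋯ < u_k < t}` of the open simplex under a product measure, written as an
iterated integral. -/
noncomputable def simplexMass (μ : Measure T) : ℕ → T → ENNReal
  | 0, _ => 1
  | k + 1, t => ∫⁻ u in Iio t, simplexMass μ k u ∂μ

theorem monotone_simplexMass (μ : Measure T) (k : ℕ) : Monotone (simplexMass μ k) := by
  cases k with
  | zero => exact fun _ _ _ => le_rfl
  | succ k => exact fun s t h => lintegral_mono_set (Iio_subset_Iio h)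

variable [TopologicalSpace T] [OrderClosedTopology T] [SecondCountableTopology T] [BorelSpace T]
  (μ : Measure T) [SFinite μ]

theorem setLIntegral_Iio_setLIntegral_Iio {f : T → ENNReal} (hf : Measurable f) (t : T) :
    ∫⁻ u in Iio t, ∫⁻ v in Iio u, f v ∂μ ∂μ = ∫⁻ v in Iio t, f v * μ (Ioo v t) ∂μ := by
  have hmeas : Measurable (Function.uncurry fun u v : T => (Ioo v t).indicator (fun _ => f v) u) :=
    (hf.comp measurable_snd).indicator <| (measurableSet_lt measurable_snd measurable_fst).inter
      (measurableSet_lt measurable_fst measurable_const)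
  calc ∫⁻ u in Iio t, ∫⁻ v in Iio u, f v ∂μ ∂μ
      = ∫⁻ u, ∫⁻ v, (Ioo v t).indicator (fun _ => f v) u ∂μ ∂μ := by
        rw [← lintegral_indicator measurableSet_Iio]
        refine lintegral_congr fun u => ?_
        by_cases hu : u < t
        · rw [indicator_of_mem (mem_Iio.2 hu), ← lintegral_indicator measurableSet_Iio]
          simp [indicator, hu]
        · simp [indicator, hu]
    _ = ∫⁻ v, f v * μ (Ioo v t) ∂μ := by
        rw [lintegral_lintegral_swap hmeas.aemeasurable]
        simp only [lintegral_indicator_const measurableSet_Ioo]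
    _ = ∫⁻ v in Iio t, f v * μ (Ioo v t) ∂μ := by
        refine (setLIntegral_eq_of_support_subset fun v hv => ?_).symm
        by_contra hvt
        exact hv (by simp [Ioo_eq_empty hvt])

theorem setLIntegral_mul_measure_Iio_add_le {f : T → ENNReal} (hf : Measurable f) (t : T) :
    ∫⁻ v in Iio t, f v * μ (Iio v) ∂μ + ∫⁻ u in Iio t, ∫⁻ v in Iio u, f v ∂μ ∂μ ≤
      μ (Iio t) * ∫⁻ v in Iio t, f v ∂μ := by
  have hIio : Measurable fun v => μ (Iio v) :=
    Monotone.measurable fun _ _ h => measure_mono (Iio_subset_Iio h)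
  rw [setLIntegral_Iio_setLIntegral_Iio μ hf, ← lintegral_add_left (hf.fun_mul hIio),
    ← lintegral_const_mul _ hf]
  refine setLIntegral_mono' measurableSet_Iio fun v hv => ?_
  rw [← mul_add, mul_comm, ← measure_union ((Iio_disjoint_Ici le_rfl).mono_right
    (Ioo_subset_Ioi_self.trans Ioi_subset_Ici_self)) measurableSet_Ioo]
  gcongr
  exact union_subset (Iio_subset_Iio (le_of_lt hv)) Ioo_subset_Iio_self

theorem succ_mul_simplexMass_succ_le (k : ℕ) (t : T) :
    (k + 1 : ENNReal) * simplexMass μ (k + 1) t ≤ μ (Iio t) * simplexMass μ k t := by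
  induction k generalizing t with
  | zero => simp [simplexMass]
  | succ k ih =>
    have hk := (monotone_simplexMass μ k).measurable
    have hk' := (monotone_simplexMass μ (k + 1)).measurable
    calc ((k + 1 : ℕ) + 1 : ENNReal) * simplexMass μ (k + 2) t
        = (∫⁻ u in Iio t, (k + 1) * simplexMass μ (k + 1) u ∂μ) + simplexMass μ (k + 2) t := by
          rw [lintegral_const_mul _ hk', Nat.cast_succ, add_mul, one_mul]
          rfl
      _ ≤ (∫⁻ u in Iio t, simplexMass μ k u * μ (Iio u) ∂μ) + simplexMass μ (k + 2) t := by
          refine add_le_add_left (lintegral_mono fun u => ?_) _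
          exact (ih u).trans_eq (mul_comm _ _)
      _ ≤ μ (Iio t) * simplexMass μ (k + 1) t := setLIntegral_mul_measure_Iio_add_le μ hk t

theorem factorial_mul_simplexMass_le (k : ℕ) (t : T) :
    (k.factorial : ENNReal) * simplexMass μ k t ≤ μ univ ^ k := by
  induction k with
  | zero => simp [simplexMass]
  | succ k ih =>
    calc ((k + 1).factorial : ENNReal) * simplexMass μ (k + 1) t
        = k.factorial * ((k + 1 : ENNReal) * simplexMass μ (k + 1) t) := by
          rw [Nat.factorial_succ]; push_cast; ring
      _ ≤ k.factorial * (μ (Iio t) * simplexMass μ k t) :=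
          mul_le_mul_right (succ_mul_simplexMass_succ_le μ k t) _
      _ = μ (Iio t) * (k.factorial * simplexMass μ k t) := by ring
      _ ≤ μ univ * μ univ ^ k := by
          gcongr
          exact subset_univ _
      _ = μ univ ^ (k + 1) := (pow_succ' _ _).symm

end SimplexMass

section ParametricIntegral

open Set Topology

variable {A T : Type*} [MeasurableSpace A] [MeasurableSpace T] {μ : A → VectorMeasure T ℝ}

theorem measurable_vectorMeasure_of_generateFrom {C : Set (Set T)}
    (hC : ‹MeasurableSpace T› = MeasurableSpace.generateFrom C) (hpi : IsPiSystem C)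
    (huniv : Measurable fun a => μ a univ) (hμ : ∀ s ∈ C, Measurable fun a => μ a s) {s : Set T}
    (hs : MeasurableSet s) : Measurable fun a => μ a s := by
  induction s, hs using MeasurableSpace.induction_on_inter hC hpi with
  | empty => simp
  | basic s hs => exact hμ s hs
  | compl s hs ih =>
    simp only [VectorMeasure.of_compl hs]
    exact huniv.sub ih
  | iUnion s hdisj hs ih =>
    refine measurable_of_tendsto_metrizable
      (fun n => Finset.measurable_sum (Finset.range n) fun j _ => ih j)
      (tendsto_pi_nhds.2 fun a => ?_)
    simpa using ((μ a).m_iUnion hs hdisj).tendsto_sum_nat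

theorem measurable_vectorMeasure_prodMk_preimage
    (hμ : ∀ s, MeasurableSet s → Measurable fun a => μ a s) {S : Set (A × T)}
    (hS : MeasurableSet S) : Measurable fun a => μ a (Prod.mk a ⁻¹' S) := by
  have hmap {S : Set (A × T)} (hS : MeasurableSet S) (a : A) :
      (μ a).map (Prod.mk a) S = μ a (Prod.mk a ⁻¹' S) :=
    VectorMeasure.map_apply _ measurable_prodMk_left hS
  simp only [← hmap hS]
  refine measurable_vectorMeasure_of_generateFrom generateFrom_prod.symm isPiSystem_prod ?_ ?_ hS
  · simpa only [hmap MeasurableSet.univ, preimage_univ] using hμ univ MeasurableSet.univ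
  · rintro _ ⟨s, hs, t, ht, rfl⟩
    have hrect (a : A) : (μ a).map (Prod.mk a) (s ×ˢ t) = s.indicator (fun a => μ a t) a := by
      rw [hmap (hs.prod ht)]
      by_cases ha : a ∈ s <;> simp [ha]
    simp only [hrect]
    exact (hμ t ht).indicator hs

variable [∀ a, IsFiniteMeasure (μ a).variation]

theorem measurable_vectorMeasure_integral_simpleFunc
    (hμ : ∀ s, MeasurableSet s → Measurable fun a => μ a s) (f : SimpleFunc (A × T) ℝ) :
    Measurable fun a => ∫ᵛ t, f (a, t) ∂•(μ a) := by
  have hsum (a : A) : ∫ᵛ t, f (a, t) ∂•(μ a) =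
      ∑ c ∈ f.range, c * μ a (Prod.mk a ⁻¹' (f ⁻¹' {c})) := by
    have hf (t : T) : f (a, t) =
        ∑ c ∈ f.range, (Prod.mk a ⁻¹' (f ⁻¹' {c})).indicator (fun _ => c) t := by
      simp only [indicator, mem_preimage, mem_singleton_iff]
      rw [Finset.sum_ite_eq, if_pos (f.mem_range_self _)]
    have hmeas (c : ℝ) : MeasurableSet (Prod.mk a ⁻¹' (f ⁻¹' {c})) :=
      measurable_prodMk_left (f.measurableSet_fiber c)
    rw [funext hf, VectorMeasure.integral_finsetSum _ fun c _ =>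
      (integrable_const _).indicator (hmeas c)]
    refine Finset.sum_congr rfl fun c _ => ?_
    rw [VectorMeasure.integral_indicator_const _ (hmeas c)]
    simp
  simp only [hsum]
  exact Finset.measurable_sum _ fun c _ =>
    (measurable_vectorMeasure_prodMk_preimage hμ (f.measurableSet_fiber c)).const_mul c

theorem measurable_vectorMeasure_integral
    (hμ : ∀ s, MeasurableSet s → Measurable fun a => μ a s) {f : A × T → ℝ} (hf : Measurable f)
    (hbdd : ∀ a, ∃ C, ∀ t, ‖f (a, t)‖ ≤ C) : Measurable fun a => ∫ᵛ t, f (a, t) ∂•(μ a) := by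
  let F : ℕ → SimpleFunc (A × T) ℝ := SimpleFunc.approxOn f hf univ 0 (mem_univ 0)
  refine measurable_of_tendsto_metrizable
    (fun n => measurable_vectorMeasure_integral_simpleFunc hμ (F n)) (tendsto_pi_nhds.2 fun a => ?_)
  obtain ⟨C, hC⟩ := hbdd a
  refine VectorMeasure.tendsto_integral_filter_of_norm_le_const
    (Eventually.of_forall fun n =>
      ((F n).measurable.comp measurable_prodMk_left).aestronglyMeasurable)
    ⟨C + C, Eventually.of_forall fun n => Eventually.of_forall fun t => ?_⟩
    (Eventually.of_forall fun t => SimpleFunc.tendsto_approxOn hf (mem_univ 0) (by simp))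
  exact (SimpleFunc.norm_approxOn_zero_le hf (mem_univ 0) _ n).trans (add_le_add (hC t) (hC t))

end ParametricIntegral

namespace BVPath

open Set Topology

variable {d : ℕ}

instance (X : BVPath d) (i : Fin d) : IsFiniteMeasure (X.stieltjes i).variation := by
  rw [← SignedMeasure.totalVariation_eq_variation]
  infer_instance

theorem eVariationOn_coord_le (X : BVPath d) (i : Fin d) :
    eVariationOn (X.coord i) univ ≤ X.tv := by
  have hlip : LipschitzWith 1 (fun v : EuclideanSpace ℝ (Fin d) => v i) :=
    LipschitzWith.of_dist_le_mul fun v w => by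
      simpa [dist_eq_norm] using PiLp.norm_apply_le (v - w) i
  simpa using! (hlip.lipschitzOnWith (s := univ)).comp_eVariationOn_le (mapsTo_univ X.1 univ)

/-- The sum of the total variations of the coordinates, a finite measure which dominates all the
Lebesgue–Stieltjes measures of the path. -/
noncomputable def domMeasure (X : BVPath d) : Measure I := ∑ i, (X.stieltjes i).variation

instance (X : BVPath d) : IsFiniteMeasure X.domMeasure := by
  unfold domMeasure; infer_instance

theorem variation_stieltjes_le_domMeasure (X : BVPath d) (i : Fin d) :
    (X.stieltjes i).variation ≤ X.domMeasure := by
  refine Measure.le_iff.2 fun s _ => ?_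
  rw [domMeasure, Measure.finsetSum_apply]
  exact Finset.single_le_sum (f := fun i => (X.stieltjes i).variation s) (fun _ _ => zero_le)
    (Finset.mem_univ i)

theorem domMeasure_univ_le (X : BVPath d) : X.domMeasure univ ≤ d * (4 * X.tv) := by
  rw [domMeasure, Measure.finsetSum_apply]
  refine (Finset.sum_le_card_nsmul _ _ (4 * X.tv) fun i _ => ?_).trans (by simp)
  exact (variation_vectorMeasure_univ_le _).trans (mul_le_mul_right (X.eVariationOn_coord_le i) _)

theorem domMeasure_real_univ_le {X : BVPath d} {K : NNReal} (hX : X.tv ≤ K) :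
    X.domMeasure.real univ ≤ d * (4 * K) := by
  have hle : X.domMeasure univ ≤ d * (4 * K) :=
    X.domMeasure_univ_le.trans (mul_le_mul_right (mul_le_mul_right hX 4) d)
  simpa [Measure.real] using ENNReal.toReal_mono (by finiteness) hle

theorem enorm_iterInt_succ_le (X : BVPath d) {k : ℕ} (w : Fin (k + 1) → Fin d) (s : Set I) :
    ‖X.iterInt (k + 1) w s‖ₑ ≤ ∫⁻ u in s, ‖X.iterInt k (Fin.init w) (Iio u)‖ₑ ∂X.domMeasure := by
  rw [iterInt]
  refine VectorMeasure.enorm_setIntegral_le_lintegral_enorm_transpose.trans ?_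
  rw [VectorMeasure.variation_transpose_lsmul]
  exact lintegral_mono'
    (Measure.restrict_mono le_rfl (X.variation_stieltjes_le_domMeasure _)) le_rfl

theorem enorm_iterInt_Iio_le_simplexMass (X : BVPath d) (k : ℕ) (w : Fin k → Fin d) (t : I) :
    ‖X.iterInt k w (Iio t)‖ₑ ≤ simplexMass X.domMeasure k t := by
  induction k generalizing t with
  | zero => simp [iterInt, simplexMass]
  | succ k ih => exact (X.enorm_iterInt_succ_le w _).trans (lintegral_mono fun u => ih _ u)

theorem factorial_mul_enorm_iterInt_Iio_le (X : BVPath d) (k : ℕ) (w : Fin k → Fin d) (t : I) :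
    (k.factorial : ENNReal) * ‖X.iterInt k w (Iio t)‖ₑ ≤ X.domMeasure univ ^ k :=
  (mul_le_mul_right (X.enorm_iterInt_Iio_le_simplexMass k w t) _).trans
    (factorial_mul_simplexMass_le _ k t)

theorem norm_iterInt_Iio_le (X : BVPath d) (k : ℕ) (w : Fin k → Fin d) (t : I) :
    ‖X.iterInt k w (Iio t)‖ ≤ X.domMeasure.real univ ^ k := by
  have hle : ‖X.iterInt k w (Iio t)‖ₑ ≤ X.domMeasure univ ^ k := by
    refine le_trans (le_mul_of_one_le_left zero_le ?_) (X.factorial_mul_enorm_iterInt_Iio_le k w t)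
    exact_mod_cast k.factorial_pos
  simpa [Measure.real] using ENNReal.toReal_mono (by finiteness) hle

theorem abs_sigCoeff_succ_le (X : BVPath d) {k : ℕ} (w : Fin (k + 1) → Fin d) :
    |X.sigCoeff w| ≤ X.domMeasure.real univ ^ (k + 1) / k.factorial := by
  have hle : (k.factorial : ENNReal) * ‖X.sigCoeff w‖ₑ ≤ X.domMeasure univ ^ (k + 1) :=
    calc (k.factorial : ENNReal) * ‖X.sigCoeff w‖ₑ
        ≤ k.factorial * ∫⁻ u in univ, ‖X.iterInt k (Fin.init w) (Iio u)‖ₑ ∂X.domMeasure :=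
          mul_le_mul_right (X.enorm_iterInt_succ_le w univ) _
      _ = ∫⁻ u, k.factorial * ‖X.iterInt k (Fin.init w) (Iio u)‖ₑ ∂X.domMeasure := by
          rw [Measure.restrict_univ, lintegral_const_mul' _ _ (by finiteness)]
      _ ≤ ∫⁻ _, X.domMeasure univ ^ k ∂X.domMeasure :=
          lintegral_mono fun u => X.factorial_mul_enorm_iterInt_Iio_le k _ u
      _ = X.domMeasure univ ^ (k + 1) := by rw [lintegral_const, pow_succ]
  rw [le_div_iff₀ (by positivity), mul_comm]
  simpa [Measure.real] using ENNReal.toReal_mono (by finiteness) hle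

theorem measurable_coord (i : Fin d) (t : I) : Measurable fun X : BVPath d => X.coord i t :=
  (EuclideanSpace.proj (𝕜 := ℝ) i).continuous.measurable.comp
    ((measurable_pi_apply t).comp measurable_subtype_coe)

theorem measurable_leftLim_coord (i : Fin d) (t : I) :
    Measurable fun X : BVPath d => (X.coord i).leftLim t := by
  by_cases h : ∃ b, b < t
  · obtain ⟨b, hb⟩ := h
    obtain ⟨u, -, hu, hlim⟩ := exists_seq_strictMono_tendsto' hb
    refine measurable_of_tendsto_metrizable (fun n => measurable_coord i (u n))
      (tendsto_pi_nhds.2 fun X => ?_)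
    exact ((X.coord_boundedVariationOn i).tendsto_leftLim t).comp
      (tendsto_nhdsWithin_of_tendsto_nhds_of_eventually_within _ hlim
        (Eventually.of_forall fun n => (hu n).2))
  · have ht : IsBot t := by simpa [IsBot] using h
    simp only [leftLim_eq_of_isBot ht]
    exact measurable_coord i t

theorem stieltjes_Iio (X : BVPath d) (i : Fin d) (t : I) :
    X.stieltjes i (Iio t) = (X.coord i).leftLim t - X.coord i 0 := by
  rw [stieltjes, BoundedVariationOn.vectorMeasure_Iio,
    atBot_eq_pure_of_isBot isBot_zero_unitInterval, (tendsto_pure_nhds _ _).limUnder_eq]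

theorem stieltjes_univ (X : BVPath d) (i : Fin d) :
    X.stieltjes i univ = X.coord i 1 - X.coord i 0 := by
  have hone : IsTop (1 : I) := fun x => x.2.2
  rw [stieltjes, BoundedVariationOn.vectorMeasure_univ,
    atBot_eq_pure_of_isBot isBot_zero_unitInterval, atTop_eq_pure_of_isTop hone,
    (tendsto_pure_nhds _ _).limUnder_eq, (tendsto_pure_nhds _ _).limUnder_eq]

theorem measurable_stieltjes {s : Set I} (hs : MeasurableSet s) (i : Fin d) :
    Measurable fun X : BVPath d => X.stieltjes i s := by
  refine measurable_vectorMeasure_of_generateFrom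
    ((BorelSpace.measurable_eq (α := I)).trans (borel_eq_generateFrom_Iio I)) isPiSystem_Iio
    ?_ ?_ hs
  · simp only [stieltjes_univ]
    exact (measurable_coord i 1).sub (measurable_coord i 0)
  · rintro _ ⟨t, rfl⟩
    simp only [stieltjes_Iio]
    exact (measurable_leftLim_coord i t).sub (measurable_coord i 0)

theorem measurable_iterInt_Iio (k : ℕ) (w : Fin k → Fin d) :
    Measurable fun p : BVPath d × I => p.1.iterInt k w (Iio p.2) := by
  induction k with
  | zero => exact measurable_const
  | succ k ih =>
    simp only [iterInt, ← VectorMeasure.integral_indicator measurableSet_Iio]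
    refine measurable_vectorMeasure_integral
      (μ := fun p : BVPath d × I => p.1.stieltjes (w (Fin.last k)))
      (f := fun q => (Iio q.1.2).indicator
        (fun v => q.1.1.iterInt k (Fin.init w) (Iio v)) q.2) (fun s hs => ?_) ?_ fun p => ?_
    · exact (measurable_stieltjes hs _).comp measurable_fst
    · exact ((ih (Fin.init w)).comp
        ((measurable_fst.comp measurable_fst).prodMk measurable_snd)).indicator
          (measurableSet_lt measurable_snd (measurable_snd.comp measurable_fst))
    · exact ⟨p.1.domMeasure.real univ ^ k, fun v =>
        (norm_indicator_le_norm_self _ _).trans (p.1.norm_iterInt_Iio_le k _ v)⟩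

theorem measurable_sigCoeff {k : ℕ} (w : Fin k → Fin d) :
    Measurable fun X : BVPath d => X.sigCoeff w := by
  cases k with
  | zero => exact measurable_const
  | succ k =>
    simp only [sigCoeff, iterInt, VectorMeasure.restrict_univ]
    exact measurable_vectorMeasure_integral
      (μ := fun X : BVPath d => X.stieltjes (w (Fin.last k)))
      (f := fun p => p.1.iterInt k (Fin.init w) (Iio p.2)) (fun s hs => measurable_stieltjes hs _)
      (measurable_iterInt_Iio k (Fin.init w)) fun X => ⟨_, X.norm_iterInt_Iio_le k _⟩

theorem sum_sq_sigCoeff_succ_le (X : BVPath d) (k : ℕ) {c : ℝ}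
    (hc : X.domMeasure.real univ ≤ c) :
    ∑ w : Fin (k + 1) → Fin d, X.sigCoeff w ^ 2 ≤
      d * c ^ 2 * ((d * c ^ 2) ^ k / k.factorial) := by
  have hterm (w : Fin (k + 1) → Fin d) : X.sigCoeff w ^ 2 ≤ (c ^ (k + 1)) ^ 2 / k.factorial := by
    have hfact : (1 : ℝ) ≤ k.factorial := by exact_mod_cast k.factorial_pos
    calc X.sigCoeff w ^ 2 = |X.sigCoeff w| ^ 2 := (sq_abs _).symm
      _ ≤ (c ^ (k + 1) / k.factorial) ^ 2 := by
          gcongr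
          exact (X.abs_sigCoeff_succ_le w).trans (by gcongr)
      _ = (c ^ (k + 1)) ^ 2 / (k.factorial : ℝ) ^ 2 := div_pow _ _ _
      _ ≤ (c ^ (k + 1)) ^ 2 / k.factorial := by
          gcongr
          exact le_self_pow₀ hfact two_ne_zero
  calc ∑ w : Fin (k + 1) → Fin d, X.sigCoeff w ^ 2
      ≤ ∑ _w : Fin (k + 1) → Fin d, (c ^ (k + 1)) ^ 2 / k.factorial :=
        Finset.sum_le_sum fun w _ => hterm w
    _ = d * c ^ 2 * ((d * c ^ 2) ^ k / k.factorial) := by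
        rw [Finset.sum_const, Finset.card_univ, Fintype.card_fun, Fintype.card_fin,
          Fintype.card_fin, nsmul_eq_mul]
        push_cast
        ring

end BVPath

section TruncSig

variable {d : ℕ}

theorem measurable_truncSig (m : ℕ) : Measurable (truncSig (d := d) m) :=
  (PiLp.continuous_toLp 2 _).measurable.comp
    (measurable_pi_lambda _ fun w => BVPath.measurable_sigCoeff w.2)

theorem norm_truncSig_sq (m : ℕ) (X : BVPath d) :
    ‖truncSig m X‖ ^ 2 = ∑ k ∈ Finset.range (m + 1), ∑ w : Fin k → Fin d, X.sigCoeff w ^ 2 := by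
  rw [EuclideanSpace.norm_sq_eq, Fintype.sum_sigma, Finset.sum_range]
  simp [truncSig]

theorem norm_truncSig_sq_le (m : ℕ) {X : BVPath d} {c : ℝ}
    (hc : X.domMeasure.real Set.univ ≤ c) :
    ‖truncSig m X‖ ^ 2 ≤ 1 + d * c ^ 2 * Real.exp (d * c ^ 2) := by
  have hempty : ∑ w : Fin 0 → Fin d, X.sigCoeff w ^ 2 = 1 := by
    simp [BVPath.sigCoeff, BVPath.iterInt]
  rw [norm_truncSig_sq, Finset.sum_range_succ', hempty, add_comm]
  gcongr
  calc ∑ k ∈ Finset.range m, ∑ w : Fin (k + 1) → Fin d, X.sigCoeff w ^ 2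
      ≤ ∑ k ∈ Finset.range m, d * c ^ 2 * ((d * c ^ 2) ^ k / k.factorial) :=
        Finset.sum_le_sum fun k _ => X.sum_sq_sigCoeff_succ_le k hc
    _ = d * c ^ 2 * ∑ k ∈ Finset.range m, (d * c ^ 2) ^ k / k.factorial :=
        (Finset.mul_sum ..).symm
    _ ≤ d * c ^ 2 * Real.exp (d * c ^ 2) := by
        gcongr
        exact Real.sum_le_exp_of_nonneg (by positivity) m

theorem exists_forall_norm_truncSig_le (d : ℕ) (K : NNReal) :
    ∃ B, 0 ≤ B ∧ ∀ (m : ℕ) (X : BVPath d), X.tv ≤ K → ‖truncSig m X‖ ≤ B :=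
  ⟨_, Real.sqrt_nonneg _, fun m _ hX =>
    Real.le_sqrt_of_sq_le (norm_truncSig_sq_le m (BVPath.domMeasure_real_univ_le hX))⟩

end TruncSig

section MeanSquare

variable {Ω ι H : Type*} [MeasurableSpace Ω] {P : Measure Ω}

theorem integral_norm_le_sqrt {E : Type*} [NormedAddCommGroup E] [IsProbabilityMeasure P]
    {V : Ω → E} (hV : MemLp V 2 P) :
    ∫ ω, ‖V ω‖ ∂P ≤ √(∫ ω, ‖V ω‖ ^ 2 ∂P) := by
  refine Real.le_sqrt_of_sq_le ?_
  have hvar := variance_nonneg (fun ω => ‖V ω‖) P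
  rw [variance_eq_sub hV.norm] at hvar
  exact sub_nonneg.1 hvar

variable [NormedAddCommGroup H] [InnerProductSpace ℝ H]

theorem integral_norm_sum_sq [Fintype ι] {U : ι → Ω → H} (hU : ∀ i, MemLp (U i) 2 P)
    (horth : Pairwise fun i j => ∫ ω, inner ℝ (U i ω) (U j ω) ∂P = 0) :
    ∫ ω, ‖∑ i, U i ω‖ ^ 2 ∂P = ∑ i, ∫ ω, ‖U i ω‖ ^ 2 ∂P := by
  have hint (i j : ι) : Integrable (fun ω => (inner ℝ (U i ω) (U j ω) : ℝ)) P :=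
    ((hU i).norm.integrable_mul (hU j).norm).mono' ((hU i).1.inner (hU j).1)
      (.of_forall fun ω => norm_inner_le_norm _ _)
  simp only [← real_inner_self_eq_norm_sq, sum_inner]
  simp only [inner_sum]
  rw [integral_finsetSum _ fun i _ => integrable_finsetSum _ fun j _ => hint i j]
  refine Finset.sum_congr rfl fun i _ => ?_
  rw [integral_finsetSum _ fun j _ => hint i j]
  exact Finset.sum_eq_single i (fun j _ hji => horth hji.symm) (by simp)

variable [IsProbabilityMeasure P] {V : Ω → H}

section

variable [Fintype ι] [MeasurableSpace H] [BorelSpace H] {Vs : ι → Ω → H}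

theorem memLp_mean_sub_integral (hV : MemLp V 2 P) (hident : ∀ i, IdentDistrib (Vs i) V P P) :
    MemLp (fun ω => (Fintype.card ι : ℝ)⁻¹ • ∑ i, Vs i ω - ∫ x, V x ∂P) 2 P :=
  ((memLp_finsetSum _ fun i _ => (hident i).memLp_iff.2 hV).const_smul _).sub (memLp_const _)

end

variable [CompleteSpace H]

theorem integral_norm_sub_integral_sq (hV : MemLp V 2 P) :
    ∫ ω, ‖V ω - ∫ x, V x ∂P‖ ^ 2 ∂P = ∫ ω, ‖V ω‖ ^ 2 ∂P - ‖∫ x, V x ∂P‖ ^ 2 := by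
  set μ := ∫ x, V x ∂P with hμ
  have hV1 : Integrable V P := hV.integrable one_le_two
  have hinner : ∫ ω, (inner ℝ (V ω) μ : ℝ) ∂P = ‖μ‖ ^ 2 := by
    simp only [real_inner_comm μ]
    rw [integral_inner hV1, ← hμ, real_inner_self_eq_norm_sq]
  have hsq : Integrable (fun ω => ‖V ω‖ ^ 2) P := hV.integrable_norm_pow two_ne_zero
  have hlin : Integrable (fun ω => 2 * (inner ℝ (V ω) μ : ℝ)) P := (hV1.inner_const μ).const_mul 2
  have hdiff : Integrable (fun ω => ‖V ω‖ ^ 2 - 2 * (inner ℝ (V ω) μ : ℝ)) P := hsq.sub hlin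
  simp only [norm_sub_sq_real]
  rw [integral_add hdiff (integrable_const _), integral_sub hsq hlin,
    integral_const_mul, hinner, integral_const, probReal_univ, one_smul]
  ring

variable [MeasurableSpace H] [BorelSpace H]

theorem integral_inner_sub_integral_eq_zero {U V : Ω → H} (hindep : IndepFun U V P)
    (hU : Integrable U P) (hV : Integrable V P) :
    ∫ ω, inner ℝ (U ω - ∫ x, U x ∂P) (V ω - ∫ x, V x ∂P) ∂P = 0 := by
  have hsub (a : H) : Measurable fun x : H => x - a := (continuous_sub_right a).measurable
  have h := (hindep.comp (hsub (∫ x, U x ∂P)) (hsub (∫ x, V x ∂P))).integral_bilin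
    (hU.sub (integrable_const _)) (hV.sub (integrable_const _)) (innerSL ℝ)
  refine h.trans ?_
  have hV0 : ∫ ω, ((fun x => x - ∫ y, V y ∂P) ∘ V) ω ∂P = 0 := by
    simp [integral_sub hV (integrable_const _)]
  rw [hV0, map_zero]

variable [Fintype ι] [Nonempty ι] {Vs : ι → Ω → H}

theorem integral_norm_mean_sub_integral_sq_le (hV : MemLp V 2 P)
    (hident : ∀ i, IdentDistrib (Vs i) V P P)
    (hindep : Pairwise fun i j => IndepFun (Vs i) (Vs j) P) :
    ∫ ω, ‖(Fintype.card ι : ℝ)⁻¹ • ∑ i, Vs i ω - ∫ x, V x ∂P‖ ^ 2 ∂P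
      ≤ (∫ ω, ‖V ω‖ ^ 2 ∂P) / Fintype.card ι := by
  set N := (Fintype.card ι : ℝ) with hNdef
  have hN : N ≠ 0 := by simp [N]
  have hVs (i : ι) : MemLp (Vs i) 2 P := (hident i).memLp_iff.2 hV
  have hVs1 (i : ι) : Integrable (Vs i) P := (hVs i).integrable one_le_two
  have hmean (ω : Ω) : N⁻¹ • ∑ i, Vs i ω - ∫ x, V x ∂P
      = N⁻¹ • ∑ i, (Vs i ω - ∫ x, Vs i x ∂P) := by
    simp only [(hident _).integral_eq, Finset.sum_sub_distrib, Finset.sum_const,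
      Finset.card_univ, smul_sub, ← Nat.cast_smul_eq_nsmul ℝ]
    rw [inv_smul_smul₀ hN]
  have hcentered (i : ι) : MemLp (fun ω => Vs i ω - ∫ x, Vs i x ∂P) 2 P :=
    (hVs i).sub (memLp_const _)
  have hvar (i : ι) : ∫ ω, ‖Vs i ω - ∫ x, Vs i x ∂P‖ ^ 2 ∂P ≤ ∫ ω, ‖V ω‖ ^ 2 ∂P := by
    rw [integral_norm_sub_integral_sq (hVs i), ((hident i).norm.pow (n := 2)).integral_eq]
    exact sub_le_self _ (sq_nonneg _)
  calc ∫ ω, ‖N⁻¹ • ∑ i, Vs i ω - ∫ x, V x ∂P‖ ^ 2 ∂P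
      = N⁻¹ ^ 2 * ∑ i, ∫ ω, ‖Vs i ω - ∫ x, Vs i x ∂P‖ ^ 2 ∂P := by
        simp only [hmean, norm_smul, mul_pow, norm_inv, Real.norm_natCast, N]
        rw [integral_const_mul, integral_norm_sum_sq hcentered fun i j hij =>
          integral_inner_sub_integral_eq_zero (hindep hij) (hVs1 i) (hVs1 j)]
    _ ≤ N⁻¹ ^ 2 * ∑ _i : ι, ∫ ω, ‖V ω‖ ^ 2 ∂P :=
        mul_le_mul_of_nonneg_left (Finset.sum_le_sum fun i _ => hvar i) (sq_nonneg _)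
    _ = (∫ ω, ‖V ω‖ ^ 2 ∂P) / N := by
        rw [Finset.sum_const, Finset.card_univ, nsmul_eq_mul, ← hNdef]
        field_simp

theorem integral_norm_mean_sub_integral_le (hV : MemLp V 2 P)
    (hident : ∀ i, IdentDistrib (Vs i) V P P)
    (hindep : Pairwise fun i j => IndepFun (Vs i) (Vs j) P) :
    ∫ ω, ‖(Fintype.card ι : ℝ)⁻¹ • ∑ i, Vs i ω - ∫ x, V x ∂P‖ ∂P
      ≤ √((∫ ω, ‖V ω‖ ^ 2 ∂P) / Fintype.card ι) :=
  (integral_norm_le_sqrt (memLp_mean_sub_integral hV hident)).trans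
    (Real.sqrt_le_sqrt (integral_norm_mean_sub_integral_sq_le hV hident hindep))

end MeanSquare

section Integration

variable {Ω : Type*} [MeasurableSpace Ω] {P : Measure Ω}

theorem integral_le_of_forall_ae_eventually_le {f : ℕ → Ω → ℝ} {g : Ω → ℝ} {C : ℝ}
    (hf : ∀ M, Integrable (f M) P) (hf0 : ∀ M ω, 0 ≤ f M ω) (hfC : ∀ M, ∫ ω, f M ω ∂P ≤ C)
    (hg0 : ∀ ω, 0 ≤ g ω) (hgf : ∀ᵐ ω ∂P, ∀ᶠ M in atTop, g ω ≤ f M ω) : ∫ ω, g ω ∂P ≤ C := by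
  have hC : 0 ≤ C := (integral_nonneg (hf0 0)).trans (hfC 0)
  by_cases hg : Integrable g P
  · rw [integral_eq_lintegral_of_nonneg_ae (.of_forall hg0) hg.1]
    refine ENNReal.toReal_le_of_le_ofReal hC ?_
    calc ∫⁻ ω, ENNReal.ofReal (g ω) ∂P
        ≤ ∫⁻ ω, liminf (fun M => ENNReal.ofReal (f M ω)) atTop ∂P :=
          lintegral_mono_ae <| hgf.mono fun ω hω =>
            le_liminf_of_le (by isBoundedDefault) (hω.mono fun M => ENNReal.ofReal_le_ofReal)
      _ ≤ liminf (fun M => ∫⁻ ω, ENNReal.ofReal (f M ω) ∂P) atTop :=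
          lintegral_liminf_le' fun M => (hf M).1.aemeasurable.ennreal_ofReal
      _ ≤ ENNReal.ofReal C := liminf_le_of_le (by isBoundedDefault) fun b hb => by
          obtain ⟨M, hM⟩ := hb.exists
          rw [← ofReal_integral_eq_lintegral_ofReal (hf M) (.of_forall (hf0 M))] at hM
          exact hM.trans (ENNReal.ofReal_le_ofReal (hfC M))
  · rwa [integral_undef hg]

theorem integral_comp_prodMk_of_indepFun {E F : Type*} [MeasurableSpace E] [MeasurableSpace F]
    [IsFiniteMeasure P] {U : Ω → E} {V : Ω → F} (hindep : IndepFun U V P)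
    (hU : AEMeasurable U P) (hV : AEMeasurable V P) {φ : E × F → ℝ} (hφ : Measurable φ)
    (hint : Integrable (fun ω => φ (U ω, V ω)) P) :
    ∫ ω, φ (U ω, V ω) ∂P = ∫ ω, ∫ ω', φ (U ω, V ω') ∂P ∂P := by
  have hprod := (indepFun_iff_map_prod_eq_prod_map_map hU hV).1 hindep
  have hint' : Integrable φ ((P.map U).prod (P.map V)) := by
    rw [← hprod]
    exact (integrable_map_measure hφ.aestronglyMeasurable (hU.prodMk hV)).2 hint
  calc ∫ ω, φ (U ω, V ω) ∂P = ∫ z, φ z ∂(P.map U).prod (P.map V) := by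
        rw [← hprod, integral_map (hU.prodMk hV) hφ.aestronglyMeasurable]
    _ = ∫ ω, ∫ y, φ (U ω, y) ∂P.map V ∂P := by
        rw [integral_prod _ hint', integral_map hU hint'.1.integral_prod_right']
    _ = ∫ ω, ∫ ω', φ (U ω, V ω') ∂P ∂P := by
        congr with ω
        exact integral_map hV (hφ.comp measurable_prodMk_left).aestronglyMeasurable

end Integration

variable {d : ℕ}

theorem inner_eq_sum_mul {W : Type*} [Fintype W] (v w : EuclideanSpace ℝ W) :
    inner ℝ v w = ∑ i, v i * w i := by
  simp only [PiLp.inner_apply, Real.inner_apply]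

section TensorSquare

variable {W : Type*}

/-- The tensor square `s ⊗ s` of a vector in coordinates, by which the square `⟨γ, s⟩²` of a
scalar product becomes the scalar product `⟨γ ⊗ γ, s ⊗ s⟩`. -/
noncomputable def tensorSq (s : EuclideanSpace ℝ W) : EuclideanSpace ℝ (W × W) :=
  WithLp.toLp 2 fun p => s p.1 * s p.2

theorem continuous_tensorSq : Continuous (tensorSq (W := W)) := by
  unfold tensorSq
  fun_prop

variable [Fintype W]

theorem inner_tensorSq (γ s : EuclideanSpace ℝ W) :
    inner ℝ (tensorSq γ) (tensorSq s) = (inner ℝ γ s : ℝ) ^ 2 := by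
  simp only [inner_eq_sum_mul, tensorSq, sq, Finset.sum_mul_sum,
    ← Finset.sum_product', Finset.univ_product_univ]
  exact Finset.sum_congr rfl fun p _ => by ring

theorem norm_tensorSq (s : EuclideanSpace ℝ W) : ‖tensorSq s‖ = ‖s‖ ^ 2 := by
  rw [← sq_eq_sq₀ (norm_nonneg _) (sq_nonneg _), ← real_inner_self_eq_norm_sq, inner_tensorSq,
    real_inner_self_eq_norm_sq]

end TensorSquare

section Padding

/-- Extension by zero of a coefficient vector of order `m` to order `M`, used to compare
predictors of different orders; coefficients of length more than `M` are dropped. -/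
noncomputable def pad {m : ℕ} (M : ℕ) (β : Coeff d m) : Coeff d M :=
  WithLp.toLp 2 fun w => if h : (w.1 : ℕ) < m + 1 then β ⟨⟨w.1, h⟩, w.2⟩ else 0

theorem sum_pad {m M : ℕ} (hm : m ≤ M) (β : Coeff d m)
    (F : (k : ℕ) → (Fin k → Fin d) → ℝ → ℝ) (hF : ∀ k w, F k w 0 = 0) :
    ∑ w, F w.1 w.2 (pad M β w) = ∑ w, F w.1 w.2 (β w) := by
  let G (k : ℕ) : ℝ := ∑ w : Fin k → Fin d, F k w (if h : k < m + 1 then β ⟨⟨k, h⟩, w⟩ else 0)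
  have hpad : ∑ w, F w.1 w.2 (pad M β w) = ∑ k ∈ Finset.range (M + 1), G k := by
    rw [Fintype.sum_sigma, Finset.sum_range]
    rfl
  have hβ : ∑ w, F w.1 w.2 (β w) = ∑ k ∈ Finset.range (m + 1), G k := by
    rw [Fintype.sum_sigma, Finset.sum_range]
    exact Finset.sum_congr rfl fun k _ => Finset.sum_congr rfl fun w _ => by rw [dif_pos k.2]
  have hzero (k : ℕ) (hk : k ∉ Finset.range (m + 1)) : G k = 0 :=
    Finset.sum_eq_zero fun w _ => by rw [dif_neg (by simpa using hk), hF]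
  rw [hpad, hβ]
  exact (Finset.sum_subset (Finset.range_mono (by lia)) fun k _ => hzero k).symm

theorem inner_pad_truncSig {m M : ℕ} (hm : m ≤ M) (β : Coeff d m) (X : BVPath d) :
    inner ℝ (pad M β) (truncSig M X) = inner ℝ β (truncSig m X) := by
  simp only [inner_eq_sum_mul, truncSig]
  exact sum_pad hm β (fun k w x => x * X.sigCoeff w) fun k w => zero_mul _

theorem norm_pad {m M : ℕ} (hm : m ≤ M) (β : Coeff d m) : ‖pad M β‖ = ‖β‖ := by
  rw [← sq_eq_sq₀ (norm_nonneg _) (norm_nonneg _), EuclideanSpace.real_norm_sq_eq,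
    EuclideanSpace.real_norm_sq_eq]
  exact sum_pad hm β (fun _ _ x => x ^ 2) fun _ _ => zero_pow two_ne_zero

theorem norm_pad_sub_pad_le {m m' M : ℕ} (hm : m ≤ M) (hm' : m' ≤ M) {α : ℝ} {β : Coeff d m}
    {β' : Coeff d m'} (hβ : ‖β‖ ≤ α) (hβ' : ‖β'‖ ≤ α) : ‖pad M β - pad M β'‖ ≤ 2 * α := by
  have htri := norm_sub_le (pad M β) (pad M β')
  rw [norm_pad hm, norm_pad hm'] at htri
  linarith

theorem continuous_pad (m M : ℕ) : Continuous (pad (d := d) (m := m) M) := by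
  refine (PiLp.continuous_toLp 2 _).comp (continuous_pi fun w => ?_)
  split_ifs <;> fun_prop

/-- The difference `⟨β, S^m(x)⟩ - ⟨β', S^{m'}(x)⟩` of the predictions at `x` of two linear
predictors, possibly of different orders. -/
noncomputable def predictionGap {m m' : ℕ} (β : Coeff d m) (β' : Coeff d m') (x : BVPath d) : ℝ :=
  inner ℝ β (truncSig m x) - inner ℝ β' (truncSig m' x)

theorem predictionGap_eq_inner {m m' M : ℕ} (hm : m ≤ M) (hm' : m' ≤ M) (β : Coeff d m)
    (β' : Coeff d m') (x : BVPath d) :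
    predictionGap β β' x = inner ℝ (pad M β - pad M β') (truncSig M x) := by
  rw [predictionGap, inner_sub_left, inner_pad_truncSig hm, inner_pad_truncSig hm']

theorem predictionGap_sq_eq_inner_tensorSq {m m' M : ℕ} (hm : m ≤ M) (hm' : m' ≤ M)
    (β : Coeff d m) (β' : Coeff d m') (x : BVPath d) :
    predictionGap β β' x ^ 2 =
      inner ℝ (tensorSq (pad M β - pad M β')) (tensorSq (truncSig M x)) := by
  rw [inner_tensorSq, predictionGap_eq_inner hm hm']

theorem abs_predictionGap_le {m m' : ℕ} {α B : ℝ} {β : Coeff d m} {β' : Coeff d m'}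
    (hβ : ‖β‖ ≤ α) (hβ' : ‖β'‖ ≤ α) {x : BVPath d} (hB : ∀ k, ‖truncSig k x‖ ≤ B) :
    |predictionGap β β' x| ≤ 2 * α * B := by
  rw [predictionGap_eq_inner (le_max_left m m') (le_max_right m m')]
  have hγ := norm_pad_sub_pad_le (le_max_left m m') (le_max_right m m') hβ hβ'
  exact (abs_real_inner_le_norm _ _).trans
    (mul_le_mul hγ (hB _) (norm_nonneg _) ((norm_nonneg _).trans hγ))

end Padding

section EmpiricalRisk

/-- The mean of a statistic `f` of one observation over the sample `D`. -/
noncomputable def sampleMean {E : Type*} [AddCommMonoid E] [Module ℝ E] {n : ℕ}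
    (f : BVPath d × ℝ → E) (D : Sample d n) : E :=
  (n : ℝ)⁻¹ • ∑ i, f (D i)

/-- The residual `y - ⟨β, S^m(x)⟩` of the linear predictor `β` at the observation `z = (x, y)`. -/
noncomputable def residual {m : ℕ} (β : Coeff d m) (z : BVPath d × ℝ) : ℝ :=
  z.2 - inner ℝ β (truncSig m z.1)

variable {n m : ℕ}

theorem measurable_inner_truncSig {T : Type*} [MeasurableSpace T] {β : T → Coeff d m}
    {x : T → BVPath d} (hβ : Measurable β) (hx : Measurable x) :
    Measurable fun t => (inner ℝ (β t) (truncSig m (x t)) : ℝ) :=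
  hβ.inner ((measurable_truncSig m).comp hx)

theorem measurable_residual (β : Coeff d m) : Measurable (residual β) :=
  measurable_snd.sub (measurable_inner_truncSig measurable_const measurable_fst)

theorem inner_sampleMean {H : Type*} [NormedAddCommGroup H] [InnerProductSpace ℝ H] (γ : H)
    (f : BVPath d × ℝ → H) (D : Sample d n) :
    inner ℝ γ (sampleMean f D) = sampleMean (fun z => (inner ℝ γ (f z) : ℝ)) D := by
  simp only [sampleMean, inner_smul_right, inner_sum, smul_eq_mul]

theorem empRisk_eq_sampleMean (D : Sample d n) (β : Coeff d m) :
    empRisk D m β = sampleMean (fun z => residual β z ^ 2) D := by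
  simp only [empRisk, sampleMean, residual, one_div, smul_eq_mul]

theorem residual_eq_sub_predictionGap {m' : ℕ} (β : Coeff d m) (β' : Coeff d m')
    (z : BVPath d × ℝ) : residual β z = residual β' z - predictionGap β β' z.1 := by
  simp only [residual, predictionGap]
  ring

theorem empRisk_sub_empRisk {m' M : ℕ} (hm : m ≤ M) (hm' : m' ≤ M) (D : Sample d n)
    (β : Coeff d m) (β' : Coeff d m') :
    empRisk D m β - empRisk D m' β' =
      inner ℝ (tensorSq (pad M β - pad M β')) (sampleMean (fun z => tensorSq (truncSig M z.1)) D) -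
        2 * inner ℝ (pad M β - pad M β')
          (sampleMean (fun z => residual β' z • truncSig M z.1) D) := by
  simp only [empRisk_eq_sampleMean, residual_eq_sub_predictionGap β β', inner_sampleMean,
    inner_smul_right, ← predictionGap_eq_inner hm hm', ← predictionGap_sq_eq_inner_tensorSq hm hm']
  simp only [sampleMean, smul_eq_mul]
  rw [mul_left_comm 2, ← mul_sub, ← mul_sub, Finset.mul_sum, ← Finset.sum_sub_distrib,
    ← Finset.sum_sub_distrib]
  congr! 2 with i
  ring

theorem empRisk_nonneg (D : Sample d n) (β : Coeff d m) : 0 ≤ empRisk D m β :=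
  mul_nonneg (by positivity) (Finset.sum_nonneg fun _ _ => sq_nonneg _)

theorem minEmpRisk_nonneg (α : ℝ) (D : Sample d n) (m : ℕ) : 0 ≤ minEmpRisk α D m :=
  Real.iInf_nonneg fun β => empRisk_nonneg D β.1

theorem IsERM.minEmpRisk_eq {α : ℝ} {b : Sample d n → Coeff d m} (hb : IsERM α b)
    (D : Sample d n) : minEmpRisk α D m = empRisk D m (b D) := by
  let βmin : Metric.closedBall (0 : Coeff d m) α :=
    ⟨b D, mem_closedBall_zero_iff.2 (hb.norm_le D)⟩
  have : Nonempty (Metric.closedBall (0 : Coeff d m) α) := ⟨βmin⟩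
  refine le_antisymm (ciInf_le ⟨0, ?_⟩ βmin)
    (le_ciInf fun β => hb.isMin D β (mem_closedBall_zero_iff.1 β.2))
  rintro _ ⟨β, rfl⟩
  exact empRisk_nonneg D β.1

theorem measurable_empRisk {b : Sample d n → Coeff d m} (hb : Measurable b) :
    Measurable fun D : Sample d n => empRisk D m (b D) := by
  refine (Finset.measurable_sum _ fun i _ => Measurable.pow_const ?_ 2).const_mul _
  have hDi : Measurable fun D : Sample d n => D i := measurable_pi_apply i
  exact (measurable_snd.comp hDi).sub
    (measurable_inner_truncSig hb (measurable_fst.comp hDi))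

end EmpiricalRisk

section OrderSelection

theorem pen_nonneg {Kpen : ℝ} (hK : 0 ≤ Kpen) (ρ : ℝ) (n m : ℕ) : 0 ≤ pen d Kpen ρ n m := by
  unfold pen
  positivity

theorem monotone_pen {Kpen : ℝ} (hK : 0 ≤ Kpen) (ρ : ℝ) (n : ℕ) :
    Monotone (pen d Kpen ρ n) := by
  intro m m' h
  have hdim : sigDim d m ≤ sigDim d m' :=
    Finset.sum_le_sum_of_subset (Finset.range_mono (by lia))
  unfold pen
  gcongr

theorem tendsto_pen_order_atTop (hd : 1 ≤ d) {Kpen : ℝ} (hK : 0 < Kpen) (ρ : ℝ) {n : ℕ}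
    (hn : 0 < n) : Tendsto (pen d Kpen ρ n) atTop atTop := by
  refine Tendsto.const_mul_atTop (by positivity) ?_
  refine Real.tendsto_sqrt_atTop.comp (tendsto_natCast_atTop_atTop.comp ?_)
  refine tendsto_atTop_mono (fun m => ?_) tendsto_id
  calc m ≤ ∑ k ∈ Finset.range (m + 1), 1 := by simp
    _ ≤ sigDim d m := Finset.sum_le_sum fun k _ => Nat.one_le_pow _ _ hd

theorem tendsto_pen_sampleSize_zero (d : ℕ) (Kpen : ℝ) {ρ : ℝ} (hρ : 0 < ρ) (m : ℕ) :
    Tendsto (fun n => pen d Kpen ρ n m) atTop (nhds 0) := by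
  have hpow := ((tendsto_rpow_neg_atTop hρ).comp tendsto_natCast_atTop_atTop).const_mul Kpen
  simpa [pen] using hpow.mul_const (√(sigDim d m : ℝ))

theorem minEmpRisk_mHat_add_pen_le (hd : 1 ≤ d) (α : ℝ) {Kpen : ℝ} (hK : 0 < Kpen) (ρ : ℝ)
    {n : ℕ} (hn : 0 < n) (D : Sample d n) (m : ℕ) :
    minEmpRisk α D (mHat α Kpen ρ D) + pen d Kpen ρ n (mHat α Kpen ρ D)
      ≤ minEmpRisk α D m + pen d Kpen ρ n m := by
  have ht : Tendsto (fun m => minEmpRisk α D m + pen d Kpen ρ n m) cofinite atTop := by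
    rw [Nat.cofinite_eq_atTop]
    exact tendsto_atTop_mono (fun m => le_add_of_nonneg_left (minEmpRisk_nonneg α D m))
      (tendsto_pen_order_atTop hd hK ρ hn)
  exact Nat.sInf_mem (s := {m | ∀ m' : ℕ,
    minEmpRisk α D m + pen d Kpen ρ n m ≤ minEmpRisk α D m' + pen d Kpen ρ n m'})
    ht.exists_forall_le m

theorem empRisk_mHat_add_pen_le (hd : 1 ≤ d) {α Kpen : ℝ} (hK : 0 < Kpen) (ρ : ℝ) {n : ℕ}
    (hn : 0 < n) {b : ∀ m, Sample d n → Coeff d m} (hb : ∀ m, IsERM α (b m)) (D : Sample d n)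
    {m : ℕ} {β : Coeff d m} (hβ : ‖β‖ ≤ α) :
    empRisk D _ (b (mHat α Kpen ρ D) D) + pen d Kpen ρ n (mHat α Kpen ρ D)
      ≤ empRisk D m β + pen d Kpen ρ n m := by
  rw [← (hb _).minEmpRisk_eq]
  refine (minEmpRisk_mHat_add_pen_le hd α hK ρ hn D m).trans ?_
  rw [(hb m).minEmpRisk_eq]
  gcongr
  exact (hb m).isMin D β hβ

theorem measurable_nat_sInf {T : Type*} [MeasurableSpace T] {p : ℕ → T → Prop}
    (hp : ∀ m, MeasurableSet {x | p m x}) : Measurable fun x => sInf {m | p m x} := by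
  refine measurable_of_Iic fun k => ?_
  have hpre : (fun x => sInf {m | p m x}) ⁻¹' Set.Iic k
      = (⋃ j ∈ Set.Iic k, {x | p j x}) ∪ ⋂ j, {x | p j x}ᶜ := by
    ext x
    simp only [Set.mem_preimage, Set.mem_Iic, Set.mem_union, Set.mem_iUnion, Set.mem_ofPred_eq,
      exists_prop, Set.mem_iInter, Set.mem_compl_iff]
    rcases Set.eq_empty_or_nonempty {m | p m x} with hempty | hne
    · have hnone : ∀ m, ¬p m x := Set.eq_empty_iff_forall_notMem.1 hempty
      simp [hnone]
    · refine ⟨fun h => .inl ⟨_, h, Nat.sInf_mem hne⟩, ?_⟩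
      rintro (⟨j, hj, hpj⟩ | h)
      · exact (Nat.sInf_le hpj).trans hj
      · exact absurd hne.some_mem (h _)
  rw [hpre]
  exact (MeasurableSet.biUnion (Set.to_countable _) fun j _ => hp j).union
    (MeasurableSet.iInter fun j => (hp j).compl)

theorem measurable_mHat {α : ℝ} (Kpen ρ : ℝ) {n : ℕ} {b : ∀ m, Sample d n → Coeff d m}
    (hb : ∀ m, IsERM α (b m)) : Measurable (mHat (d := d) (n := n) α Kpen ρ) := by
  refine measurable_nat_sInf fun m => ?_
  simp only [(hb _).minEmpRisk_eq, Set.ofPred_forall]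
  exact MeasurableSet.iInter fun m' => measurableSet_le
    ((measurable_empRisk (hb m).measurable).add_const _)
    ((measurable_empRisk (hb m').measurable).add_const _)

end OrderSelection

section ExcessRisk

variable {Ω : Type*} [MeasurableSpace Ω] {P : Measure Ω} {X : Ω → BVPath d} {Y : Ω → ℝ}
  {m m' : ℕ} {α B : ℝ}

/-- The mean square distance between the predictions of `β` and `β'` at the random path `X`; it is
the excess risk of `β` when `β'` represents the regression function. -/
noncomputable def excessRisk (P : Measure Ω) (X : Ω → BVPath d) (β : Coeff d m)
    (β' : Coeff d m') : ℝ :=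
  ∫ ω, predictionGap β β' (X ω) ^ 2 ∂P

theorem excessRisk_nonneg (β : Coeff d m) (β' : Coeff d m') : 0 ≤ excessRisk P X β β' :=
  integral_nonneg fun _ => sq_nonneg _

theorem measurable_predictionGap {T : Type*} [MeasurableSpace T] {β : T → Coeff d m}
    {x : T → BVPath d} (hβ : Measurable β) (hx : Measurable x) (β' : Coeff d m') :
    Measurable fun t => predictionGap (β t) β' (x t) :=
  (measurable_inner_truncSig hβ hx).sub (measurable_inner_truncSig measurable_const hx)

theorem measurable_residual_smul_truncSig (β : Coeff d m) (M : ℕ) :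
    Measurable fun z : BVPath d × ℝ => residual β z • truncSig M z.1 :=
  (measurable_residual β).smul ((measurable_truncSig M).comp measurable_fst)

theorem measurable_tensorSq_truncSig (M : ℕ) :
    Measurable fun z : BVPath d × ℝ => tensorSq (truncSig M z.1) :=
  continuous_tensorSq.measurable.comp ((measurable_truncSig M).comp measurable_fst)

variable [IsFiniteMeasure P]

theorem memLp_tensorSq_truncSig (hX : Measurable X) (hB : ∀ᵐ ω ∂P, ∀ k, ‖truncSig k (X ω)‖ ≤ B)
    (M : ℕ) (p : ENNReal) : MemLp (fun ω => tensorSq (truncSig M (X ω))) p P := by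
  refine .of_bound (continuous_tensorSq.measurable.comp
    ((measurable_truncSig M).comp hX)).aestronglyMeasurable (B ^ 2) (hB.mono fun ω hω => ?_)
  rw [norm_tensorSq]
  exact pow_le_pow_left₀ (norm_nonneg _) (hω M) 2

theorem memLp_residual (hX : Measurable X) (hY : MemLp Y 2 P)
    (hB : ∀ᵐ ω ∂P, ∀ k, ‖truncSig k (X ω)‖ ≤ B) (β : Coeff d m) :
    MemLp (fun ω => residual β (X ω, Y ω)) 2 P :=
  hY.sub (MemLp.const_inner β <| .of_bound ((measurable_truncSig m).comp hX).aestronglyMeasurable B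
    (hB.mono fun _ hω => hω m))

theorem memLp_smul_truncSig (hX : Measurable X) (hB : ∀ᵐ ω ∂P, ∀ k, ‖truncSig k (X ω)‖ ≤ B)
    (M : ℕ) {f : Ω → ℝ} {p : ENNReal} (hf : MemLp f p P) :
    MemLp (fun ω => f ω • truncSig M (X ω)) p P :=
  (MemLp.of_bound (p := ⊤) ((measurable_truncSig M).comp hX).aestronglyMeasurable B
    (hB.mono fun _ hω => hω M)).smul hf

theorem excessRisk_eq_inner (hX : Measurable X) (hB : ∀ᵐ ω ∂P, ∀ k, ‖truncSig k (X ω)‖ ≤ B)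
    {M : ℕ} (hm : m ≤ M) (hm' : m' ≤ M) (β : Coeff d m) (β' : Coeff d m') :
    excessRisk P X β β' = inner ℝ (tensorSq (pad M β - pad M β'))
      (∫ ω, tensorSq (truncSig M (X ω)) ∂P) := by
  simp only [excessRisk, predictionGap_sq_eq_inner_tensorSq hm hm']
  exact integral_inner ((memLp_tensorSq_truncSig hX hB M 1).integrable le_rfl) _

theorem integrable_predictionGap_sq (hX : Measurable X)
    (hB : ∀ᵐ ω ∂P, ∀ k, ‖truncSig k (X ω)‖ ≤ B) (β : Coeff d m) (β' : Coeff d m') :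
    Integrable (fun ω => predictionGap β β' (X ω) ^ 2) P := by
  simp only [predictionGap_sq_eq_inner_tensorSq (le_max_left m m') (le_max_right m m')]
  exact ((memLp_tensorSq_truncSig hX hB _ 1).integrable le_rfl).const_inner _

theorem continuous_excessRisk (hX : Measurable X) (hB : ∀ᵐ ω ∂P, ∀ k, ‖truncSig k (X ω)‖ ≤ B)
    (β' : Coeff d m') : Continuous fun β : Coeff d m => excessRisk P X β β' := by
  simp only [excessRisk_eq_inner hX hB (le_max_left m m') (le_max_right m m')]
  exact (continuous_tensorSq.comp ((continuous_pad m _).sub continuous_const)).inner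
    continuous_const

theorem IsRegression.of_excessRisk_eq_zero {β' : Coeff d m'} (hβ' : IsRegression P X Y m' β')
    (hX : Measurable X) (hB : ∀ᵐ ω ∂P, ∀ k, ‖truncSig k (X ω)‖ ≤ B) {β : Coeff d m}
    (h0 : excessRisk P X β β' = 0) : IsRegression P X Y m β := by
  have hae := (integral_eq_zero_iff_of_nonneg (fun _ => sq_nonneg _)
    (integrable_predictionGap_sq hX hB β β')).1 h0
  filter_upwards [hβ', hae] with ω hω h
  rw [hω]
  exact (sub_eq_zero.1 (pow_eq_zero_iff two_ne_zero |>.1 h)).symm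

theorem exists_pos_forall_le_excessRisk {β' : Coeff d m'} (hβ' : IsRegression P X Y m' β')
    (hX : Measurable X) (hB : ∀ᵐ ω ∂P, ∀ k, ‖truncSig k (X ω)‖ ≤ B) (hα : 0 ≤ α)
    (hm : ∀ β : Coeff d m, ‖β‖ ≤ α → ¬IsRegression P X Y m β) :
    ∃ δ > 0, ∀ β : Coeff d m, ‖β‖ ≤ α → δ ≤ excessRisk P X β β' := by
  obtain ⟨β₀, hβ₀, hβ₀min⟩ := (isCompact_closedBall (0 : Coeff d m) α).exists_isMinOn
    ⟨0, Metric.mem_closedBall_self hα⟩ (continuous_excessRisk hX hB β').continuousOn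
  refine ⟨_, (excessRisk_nonneg β₀ β').lt_of_ne' fun h0 => ?_,
    fun β hβ => hβ₀min (mem_closedBall_zero_iff.2 hβ)⟩
  exact hm β₀ (mem_closedBall_zero_iff.1 hβ₀) (hβ'.of_excessRisk_eq_zero hX hB h0)

theorem exists_pos_forall_lt_le_excessRisk {mstar : ℕ} {βstar : Coeff d mstar}
    (hβstar : IsRegression P X Y mstar βstar) (hX : Measurable X)
    (hB : ∀ᵐ ω ∂P, ∀ k, ‖truncSig k (X ω)‖ ≤ B) (hα : 0 ≤ α)
    (hmin : ∀ m < mstar, ∀ β : Coeff d m, ‖β‖ ≤ α → ¬IsRegression P X Y m β) :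
    ∃ δ > 0, ∀ m < mstar, ∀ β : Coeff d m, ‖β‖ ≤ α → δ ≤ excessRisk P X β βstar := by
  have hgap (m : ℕ) (hm : m < mstar) :
      ∀ᶠ δ in nhdsWithin 0 (Set.Ioi 0), ∀ β : Coeff d m, ‖β‖ ≤ α → δ ≤ excessRisk P X β βstar := by
    obtain ⟨c, hc, hcle⟩ := exists_pos_forall_le_excessRisk hβstar hX hB hα (hmin m hm)
    filter_upwards [Ioc_mem_nhdsGT hc] with δ hδ β hβ using hδ.2.trans (hcle β hβ)
  have hall := (eventually_all_finite (Set.finite_Iio mstar)).2 hgap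
  exact (hall.and self_mem_nhdsWithin).exists.imp fun _ h => h.symm

theorem IsRegression.integral_residual_smul_truncSig {β : Coeff d m}
    (h : IsRegression P X Y m β) (hX : Measurable X) (hY : Integrable Y P)
    (hB : ∀ᵐ ω ∂P, ∀ k, ‖truncSig k (X ω)‖ ≤ B) (M : ℕ) :
    ∫ ω, residual β (X ω, Y ω) • truncSig M (X ω) ∂P = 0 := by
  have hYS : Integrable (fun ω => Y ω • truncSig M (X ω)) P :=
    (memLp_smul_truncSig hX hB M (memLp_one_iff_integrable.2 hY)).integrable le_rfl
  have hf : MemLp (fun ω => (inner ℝ β (truncSig m (X ω)) : ℝ)) 1 P :=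
    MemLp.const_inner β <| .of_bound ((measurable_truncSig m).comp hX).aestronglyMeasurable B
      (hB.mono fun _ hω => hω m)
  have hfS := (memLp_smul_truncSig hX hB M hf).integrable le_rfl
  have hpull := condExp_smul_of_aestronglyMeasurable_right hY hYS
    ((measurable_truncSig M).comp (comap_measurable X)).aestronglyMeasurable
  simp only [residual, sub_smul]
  rw [integral_sub hYS hfS, sub_eq_zero]
  calc ∫ ω, Y ω • truncSig M (X ω) ∂P
      = ∫ ω, (P[Y • fun ω => truncSig M (X ω) | MeasurableSpace.comap X inferInstance]) ω ∂P :=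
        (integral_condExp hX.comap_le).symm
    _ = _ := by
        refine integral_congr_ae ?_
        filter_upwards [hpull, h] with ω hω hreg
        rw [hω, Pi.smul_apply', hreg]

end ExcessRisk

section SelectedEstimator

variable {Ω : Type*} [MeasurableSpace Ω] {P : Measure Ω} [IsFiniteMeasure P] {X : Ω → BVPath d}
  {mstar n : ℕ} {βstar : Coeff d mstar} {α B : ℝ}
  {D : Ω → Sample d n} {k : Sample d n → ℕ} {b : ∀ m, Sample d n → Coeff d m}

theorem measurable_predictionGap_selected (hk : Measurable k) (hb : ∀ m, Measurable (b m))
    (βstar : Coeff d mstar) :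
    Measurable fun z : Sample d n × BVPath d => predictionGap (b (k z.1) z.1) βstar z.2 := by
  have hjoint : Measurable fun q : ℕ × Sample d n × BVPath d =>
      predictionGap (b q.1 q.2.1) βstar q.2.2 :=
    measurable_from_prod_countable_right fun m =>
      measurable_predictionGap ((hb m).comp measurable_fst) measurable_snd βstar
  exact hjoint.comp ((hk.comp measurable_fst).prodMk measurable_id)

theorem integrable_predictionGap_selected_sq (hk : Measurable k) (hb : ∀ m, Measurable (b m))
    (hD : AEMeasurable D P) (hX : AEMeasurable X P) (hB : ∀ᵐ ω ∂P, ∀ j, ‖truncSig j (X ω)‖ ≤ B)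
    (hbα : ∀ m D, ‖b m D‖ ≤ α) (hα : ‖βstar‖ ≤ α) :
    Integrable (fun ω => predictionGap (b (k (D ω)) (D ω)) βstar (X ω) ^ 2) P := by
  refine .of_bound (((measurable_predictionGap_selected hk hb βstar).comp_aemeasurable
    (hD.prodMk hX)).pow_const 2).aestronglyMeasurable ((2 * α * B) ^ 2) (hB.mono fun ω hω => ?_)
  rw [norm_pow]
  exact pow_le_pow_left₀ (norm_nonneg _) (abs_predictionGap_le (hbα _ _) hα hω) 2

theorem integral_predictionGap_selected_sq (hk : Measurable k) (hb : ∀ m, Measurable (b m))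
    (hD : AEMeasurable D P) (hX : AEMeasurable X P) (hindep : IndepFun D X P)
    (hB : ∀ᵐ ω ∂P, ∀ j, ‖truncSig j (X ω)‖ ≤ B) (hbα : ∀ m D, ‖b m D‖ ≤ α) (hα : ‖βstar‖ ≤ α) :
    ∫ ω, predictionGap (b (k (D ω)) (D ω)) βstar (X ω) ^ 2 ∂P
      = ∫ ω, excessRisk P X (b (k (D ω)) (D ω)) βstar ∂P :=
  integral_comp_prodMk_of_indepFun hindep hD hX
    ((measurable_predictionGap_selected hk hb βstar).pow_const 2)
    (integrable_predictionGap_selected_sq hk hb hD hX hB hbα hα)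

end SelectedEstimator

section Fluctuation

variable {Ω : Type*} [MeasurableSpace Ω] {P : Measure Ω} {X : Ω → BVPath d} {Y : Ω → ℝ}
  {mstar M n : ℕ} {βstar : Coeff d mstar} {α B : ℝ}

/-- A bound for the deviation of the empirical from the population risk gap to `βstar`, uniform
over the coefficients of norm at most `α` and order at most `M`. The first term holds the empirical
correlation of the residuals of `βstar` with the signature, which vanishes in expectation, and the
second one the deviation of the empirical second moment of the signature. -/
noncomputable def fluctuation (P : Measure Ω) (X : Ω → BVPath d) (βstar : Coeff d mstar) (α : ℝ)
    (M : ℕ) (D : Sample d n) : ℝ :=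
  4 * α * ‖sampleMean (fun z => residual βstar z • truncSig M z.1) D‖ +
    4 * α ^ 2 * ‖sampleMean (fun z => tensorSq (truncSig M z.1)) D
      - ∫ ω, tensorSq (truncSig M (X ω)) ∂P‖

theorem fluctuation_nonneg (hα : 0 ≤ α) (βstar : Coeff d mstar) (M : ℕ) (D : Sample d n) :
    0 ≤ fluctuation P X βstar α M D := by
  unfold fluctuation
  positivity

theorem excessRisk_le_fluctuation_add [IsFiniteMeasure P] (hX : Measurable X)
    (hB : ∀ᵐ ω ∂P, ∀ k, ‖truncSig k (X ω)‖ ≤ B) (hα : ‖βstar‖ ≤ α) {m : ℕ} (hm : m ≤ M)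
    (hM : mstar ≤ M) {β : Coeff d m} (hβ : ‖β‖ ≤ α) (D : Sample d n) :
    excessRisk P X β βstar
      ≤ fluctuation P X βstar α M D + (empRisk D m β - empRisk D mstar βstar) := by
  rw [excessRisk_eq_inner hX hB hm hM, empRisk_sub_empRisk hm hM, fluctuation]
  set γ := pad M β - pad M βstar
  set A := sampleMean (fun z => tensorSq (truncSig M z.1)) D
  set G := ∫ ω, tensorSq (truncSig M (X ω)) ∂P
  set R := sampleMean (fun z => residual βstar z • truncSig M z.1) D
  have hγ : ‖γ‖ ≤ 2 * α := norm_pad_sub_pad_le hm hM hβ hα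
  have hlinear : (inner ℝ γ R : ℝ) ≤ 2 * α * ‖R‖ :=
    (real_inner_le_norm γ R).trans (by gcongr)
  have hquadratic : (inner ℝ (tensorSq γ) (G - A) : ℝ) ≤ (2 * α) ^ 2 * ‖A - G‖ := by
    refine (real_inner_le_norm _ _).trans ?_
    rw [norm_tensorSq, norm_sub_rev G A]
    gcongr
  rw [inner_sub_right] at hquadratic
  linarith

theorem excessRisk_mHat_le_two_mul_fluctuation [IsFiniteMeasure P] (hd : 1 ≤ d)
    (hX : Measurable X) (hB : ∀ᵐ ω ∂P, ∀ k, ‖truncSig k (X ω)‖ ≤ B) (hα : ‖βstar‖ ≤ α) {δ : ℝ}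
    (hδ : ∀ m < mstar, ∀ β : Coeff d m, ‖β‖ ≤ α → δ ≤ excessRisk P X β βstar)
    {Kpen ρ : ℝ} (hKpen : 0 < Kpen) (hn : 0 < n) (hpen : pen d Kpen ρ n mstar ≤ δ / 2)
    {b : ∀ m, Sample d n → Coeff d m} (hb : ∀ m, IsERM α (b m)) (D : Sample d n)
    (hM : mstar ≤ M) (hm : mHat α Kpen ρ D ≤ M) :
    excessRisk P X (b (mHat α Kpen ρ D) D) βstar ≤ 2 * fluctuation P X βstar α M D := by
  have hβ := (hb (mHat α Kpen ρ D)).norm_le D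
  have hselect := empRisk_mHat_add_pen_le hd hKpen ρ hn hb D hα
  have hrisk := excessRisk_le_fluctuation_add hX hB hα hm hM hβ D
  have hfluct := fluctuation_nonneg (P := P) (X := X) ((norm_nonneg _).trans hα) βstar M D
  rcases le_or_gt mstar (mHat α Kpen ρ D) with hle | hlt
  · have := monotone_pen (d := d) hKpen.le ρ n hle
    linarith
  · have := hδ _ hlt _ hβ
    have := pen_nonneg (d := d) hKpen.le ρ n (mHat α Kpen ρ D)
    linarith

end Fluctuation

section RateOfConvergence

variable {Ω : Type*} [MeasurableSpace Ω] {P : Measure Ω} [IsProbabilityMeasure P]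

section SampleMean

variable {H : Type*} [NormedAddCommGroup H] [InnerProductSpace ℝ H] [MeasurableSpace H]
  [BorelSpace H] {Z : Ω → BVPath d × ℝ} {Zs : ℕ → Ω → BVPath d × ℝ} {f : BVPath d × ℝ → H}

theorem integrable_norm_sampleMean_sub_integral (hf : Measurable f)
    (hfZ : MemLp (fun ω => f (Z ω)) 2 P) (hident : ∀ i, IdentDistrib (Zs i) Z P P) (n : ℕ) :
    Integrable (fun ω => ‖sampleMean f (fun i : Fin n => Zs i ω) - ∫ ω, f (Z ω) ∂P‖) P := by
  have h := memLp_mean_sub_integral hfZ fun i : Fin n => (hident i).comp hf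
  rw [Fintype.card_fin] at h
  exact (h.integrable one_le_two).norm

theorem integral_norm_sampleMean_sub_integral_le [CompleteSpace H] (hf : Measurable f)
    (hfZ : MemLp (fun ω => f (Z ω)) 2 P) (hident : ∀ i, IdentDistrib (Zs i) Z P P)
    (hindep : Pairwise fun i j => IndepFun (Zs i) (Zs j) P) {c : ℝ} (hc : 0 ≤ c)
    (hfc : ∫ ω, ‖f (Z ω)‖ ^ 2 ∂P ≤ c ^ 2) {n : ℕ} (hn : 0 < n) :
    ∫ ω, ‖sampleMean f (fun i : Fin n => Zs i ω) - ∫ ω, f (Z ω) ∂P‖ ∂P ≤ c / √n := by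
  have : Nonempty (Fin n) := Fin.pos_iff_nonempty.1 hn
  have h := integral_norm_mean_sub_integral_le hfZ (fun i : Fin n => (hident i).comp hf)
    fun i j hij => (hindep (Fin.val_injective.ne hij)).comp hf hf
  rw [Fintype.card_fin] at h
  refine h.trans ?_
  rw [Real.sqrt_div' _ n.cast_nonneg]
  gcongr
  exact (Real.sqrt_le_sqrt hfc).trans_eq (Real.sqrt_sq hc)

end SampleMean

variable {X : Ω → BVPath d} {Y : Ω → ℝ} {Xs : ℕ → Ω → BVPath d} {Ys : ℕ → Ω → ℝ}
  {mstar n : ℕ} {βstar : Coeff d mstar} {α B : ℝ}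

theorem integrable_fluctuation (hX : Measurable X) (hY : MemLp Y 2 P)
    (hident : ∀ i, IdentDistrib (fun ω => (Xs i ω, Ys i ω)) (fun ω => (X ω, Y ω)) P P)
    (hB : ∀ᵐ ω ∂P, ∀ k, ‖truncSig k (X ω)‖ ≤ B) (hβstar : IsRegression P X Y mstar βstar)
    (α : ℝ) (M n : ℕ) :
    Integrable (fun ω => fluctuation P X βstar α M fun i : Fin n => (Xs i ω, Ys i ω)) P := by
  have hcross := integrable_norm_sampleMean_sub_integral (measurable_residual_smul_truncSig βstar M)
    (memLp_smul_truncSig hX hB M (memLp_residual hX hY hB βstar)) hident n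
  have hsecond := integrable_norm_sampleMean_sub_integral (measurable_tensorSq_truncSig M)
    (memLp_tensorSq_truncSig hX hB M 2) hident n
  simp only [hβstar.integral_residual_smul_truncSig hX (hY.integrable one_le_two) hB M,
    sub_zero] at hcross
  exact (hcross.const_mul _).add (hsecond.const_mul _)

theorem integral_norm_residual_smul_truncSig_sq_le (hX : Measurable X) (hY : MemLp Y 2 P)
    (hB : ∀ᵐ ω ∂P, ∀ k, ‖truncSig k (X ω)‖ ≤ B) (M : ℕ) :
    ∫ ω, ‖residual βstar (X ω, Y ω) • truncSig M (X ω)‖ ^ 2 ∂P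
      ≤ (√(∫ ω, residual βstar (X ω, Y ω) ^ 2 ∂P) * B) ^ 2 := by
  rw [mul_pow, Real.sq_sqrt (integral_nonneg fun _ => sq_nonneg _), ← integral_mul_const]
  refine integral_mono_of_nonneg (.of_forall fun _ => by positivity)
    ((memLp_residual hX hY hB βstar).integrable_sq.mul_const _) (hB.mono fun ω hω => ?_)
  simp only [norm_smul, mul_pow, Real.norm_eq_abs, sq_abs]
  have := hω M
  gcongr

theorem integral_norm_tensorSq_truncSig_sq_le (hB : ∀ᵐ ω ∂P, ∀ k, ‖truncSig k (X ω)‖ ≤ B)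
    (M : ℕ) : ∫ ω, ‖tensorSq (truncSig M (X ω))‖ ^ 2 ∂P ≤ (B ^ 2) ^ 2 := by
  refine (integral_mono_of_nonneg (.of_forall fun _ => by positivity)
    (integrable_const ((B ^ 2) ^ 2)) (hB.mono fun ω hω => ?_)).trans_eq (by simp)
  simp only [norm_tensorSq]
  have := hω M
  gcongr

theorem integral_fluctuation_le (hX : Measurable X) (hY : MemLp Y 2 P)
    (hident : ∀ i, IdentDistrib (fun ω => (Xs i ω, Ys i ω)) (fun ω => (X ω, Y ω)) P P)
    (hindep : Pairwise fun i j =>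
      IndepFun (fun ω => (Xs i ω, Ys i ω)) (fun ω => (Xs j ω, Ys j ω)) P)
    (hB0 : 0 ≤ B) (hB : ∀ᵐ ω ∂P, ∀ k, ‖truncSig k (X ω)‖ ≤ B)
    (hβstar : IsRegression P X Y mstar βstar) (hα : 0 ≤ α) (M : ℕ) (hn : 0 < n) :
    ∫ ω, fluctuation P X βstar α M (fun i : Fin n => (Xs i ω, Ys i ω)) ∂P
      ≤ (4 * α * (√(∫ ω, residual βstar (X ω, Y ω) ^ 2 ∂P) * B) + 4 * α ^ 2 * B ^ 2) / √n := by
  have hcrossint := (integrable_norm_sampleMean_sub_integral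
    (measurable_residual_smul_truncSig βstar M)
    (memLp_smul_truncSig hX hB M (memLp_residual hX hY hB βstar)) hident n).const_mul (4 * α)
  have hsecondint := (integrable_norm_sampleMean_sub_integral (measurable_tensorSq_truncSig M)
    (memLp_tensorSq_truncSig hX hB M 2) hident n).const_mul (4 * α ^ 2)
  have hcross := integral_norm_sampleMean_sub_integral_le
    (measurable_residual_smul_truncSig βstar M)
    (memLp_smul_truncSig hX hB M (memLp_residual hX hY hB βstar)) hident hindep (by positivity)
    (integral_norm_residual_smul_truncSig_sq_le hX hY hB M) hn
  have hsecond := integral_norm_sampleMean_sub_integral_le (measurable_tensorSq_truncSig M)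
    (memLp_tensorSq_truncSig hX hB M 2) hident hindep (by positivity)
    (integral_norm_tensorSq_truncSig_sq_le hB M) hn
  simp only [hβstar.integral_residual_smul_truncSig hX (hY.integrable one_le_two) hB M,
    sub_zero] at hcrossint hcross
  simp only [fluctuation]
  rw [integral_add hcrossint hsecondint, integral_const_mul, integral_const_mul, add_div,
    mul_div_assoc, mul_div_assoc (4 * α ^ 2)]
  exact add_le_add (mul_le_mul_of_nonneg_left hcross (by positivity))
    (mul_le_mul_of_nonneg_left hsecond (by positivity))

theorem integral_predictionGap_mHat_sq_le (hd : 1 ≤ d) (hX : Measurable X) (hY : MemLp Y 2 P)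
    (hident : ∀ i, IdentDistrib (fun ω => (Xs i ω, Ys i ω)) (fun ω => (X ω, Y ω)) P P)
    (hindep : Pairwise fun i j =>
      IndepFun (fun ω => (Xs i ω, Ys i ω)) (fun ω => (Xs j ω, Ys j ω)) P)
    (hfresh : IndepFun (fun ω => (X ω, Y ω)) (fun ω i => (Xs i ω, Ys i ω)) P)
    (hB0 : 0 ≤ B) (hB : ∀ᵐ ω ∂P, ∀ k, ‖truncSig k (X ω)‖ ≤ B)
    (hβstar : IsRegression P X Y mstar βstar) (hα : ‖βstar‖ ≤ α) {δ : ℝ}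
    (hδ : ∀ m < mstar, ∀ β : Coeff d m, ‖β‖ ≤ α → δ ≤ excessRisk P X β βstar)
    {Kpen ρ : ℝ} (hKpen : 0 < Kpen) (hn : 0 < n) (hpen : pen d Kpen ρ n mstar ≤ δ / 2)
    {b : ∀ m, Sample d n → Coeff d m} (hb : ∀ m, IsERM α (b m)) :
    let D : Ω → Sample d n := fun ω i => (Xs i ω, Ys i ω)
    ∫ ω, predictionGap (b (mHat α Kpen ρ (D ω)) (D ω)) βstar (X ω) ^ 2 ∂P
      ≤ 2 * ((4 * α * (√(∫ ω, residual βstar (X ω, Y ω) ^ 2 ∂P) * B) + 4 * α ^ 2 * B ^ 2)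
        / √n) := by
  intro D
  have hα0 : 0 ≤ α := (norm_nonneg _).trans hα
  have hD : AEMeasurable D P := aemeasurable_pi_lambda _ fun i => (hident i).aemeasurable_fst
  have hDX : IndepFun D X P := hfresh.symm.comp
    (measurable_pi_lambda (fun s (i : Fin n) => s i) fun i => measurable_pi_apply _) measurable_fst
  rw [integral_predictionGap_selected_sq (measurable_mHat Kpen ρ hb) (fun m => (hb m).measurable)
    hD hX.aemeasurable hDX hB (fun m => (hb m).norm_le) hα]
  refine integral_le_of_forall_ae_eventually_le
    (f := fun M ω => 2 * fluctuation P X βstar α M (D ω))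
    (fun M => (integrable_fluctuation hX hY hident hB hβstar α M n).const_mul 2)
    (fun M ω => mul_nonneg two_pos.le (fluctuation_nonneg hα0 βstar M _)) (fun M => ?_)
    (fun ω => excessRisk_nonneg _ _) (.of_forall fun ω => ?_)
  · rw [integral_const_mul]
    exact mul_le_mul_of_nonneg_left
      (integral_fluctuation_le hX hY hident hindep hB0 hB hβstar hα0 M hn) two_pos.le
  · filter_upwards [eventually_ge_atTop mstar, eventually_ge_atTop (mHat α Kpen ρ (D ω))]
      with M hM hm
    exact excessRisk_mHat_le_two_mul_fluctuation hd hX hB hα hδ hKpen hn hpen hb _ hM hm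

end RateOfConvergence

end SigReg

theorem corollary1_general {Ω : Type*} [MeasurableSpace Ω] (P : Measure Ω)
    [IsProbabilityMeasure P] {d : ℕ} (hd : 1 ≤ d)
    (X : Ω → SigReg.BVPath d) (Y : Ω → ℝ) (Xs : ℕ → Ω → SigReg.BVPath d) (Ys : ℕ → Ω → ℝ)
    (hX : Measurable X) (hY : MemLp Y 2 P)
    (hident : ∀ i, IdentDistrib (fun ω => (Xs i ω, Ys i ω)) (fun ω => (X ω, Y ω)) P P)
    (hindep : Pairwise fun i j =>
      IndepFun (fun ω => (Xs i ω, Ys i ω)) (fun ω => (Xs j ω, Ys j ω)) P)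
    (hfresh : IndepFun (fun ω => (X ω, Y ω)) (fun ω i => (Xs i ω, Ys i ω)) P)
    (α : ℝ) (mstar : ℕ)
    (hmin : ∀ m < mstar, ∀ β : SigReg.Coeff d m, ‖β‖ ≤ α → ¬SigReg.IsRegression P X Y m β)
    (βstar : SigReg.Coeff d mstar) (hβstar : SigReg.IsRegression P X Y mstar βstar)
    (hα : ‖βstar‖ ≤ α) (K : NNReal) (hK : ∀ᵐ ω ∂P, (X ω).tv ≤ K)
    (Kpen ρ : ℝ) (hKpen : 0 < Kpen) (hρ : 0 < ρ)
    (βhat : ∀ n m : ℕ, SigReg.Sample d n → SigReg.Coeff d m)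
    (hβhat : ∀ n m, SigReg.IsERM α (βhat n m)) :
    let D : (n : ℕ) → Ω → SigReg.Sample d n := fun n ω i => (Xs i ω, Ys i ω)
    let mhat : ℕ → Ω → ℕ := fun n ω => SigReg.mHat α Kpen ρ (D n ω)
    let err : ℕ → Ω → ℝ := fun n ω =>
      inner ℝ (βhat n (mhat n ω) (D n ω)) (SigReg.truncSig (mhat n ω) (X ω)) -
        inner ℝ βstar (SigReg.truncSig mstar (X ω))
    (∀ n, Integrable (fun ω => err n ω ^ 2) P) ∧
      (fun n => ∫ ω, err n ω ^ 2 ∂P) =O[atTop] (fun n : ℕ => (n : ℝ) ^ (-(1 / 2) : ℝ)) := by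
  intro D mhat err
  obtain ⟨B, hB0, hBtv⟩ := SigReg.exists_forall_norm_truncSig_le d K
  have hB : ∀ᵐ ω ∂P, ∀ m, ‖SigReg.truncSig m (X ω)‖ ≤ B := hK.mono fun ω hω m => hBtv m _ hω
  have hD (n : ℕ) : AEMeasurable (D n) P :=
    aemeasurable_pi_lambda _ fun i => (hident i).aemeasurable_fst
  refine ⟨fun n => SigReg.integrable_predictionGap_selected_sq (b := βhat n)
    (k := SigReg.mHat α Kpen ρ) (SigReg.measurable_mHat Kpen ρ (hβhat n))
    (fun m => (hβhat n m).measurable) (hD n) hX.aemeasurable hB (fun m => (hβhat n m).norm_le)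
    hα, ?_⟩
  obtain ⟨δ, hδ, hgap⟩ := SigReg.exists_pos_forall_lt_le_excessRisk hβstar hX hB
    ((norm_nonneg _).trans hα) hmin
  have hpen := (SigReg.tendsto_pen_sampleSize_zero d Kpen hρ mstar).eventually_le_const
    (half_pos hδ)
  refine .of_bound (2 * (4 * α * (√(∫ ω, SigReg.residual βstar (X ω, Y ω) ^ 2 ∂P) * B) +
    4 * α ^ 2 * B ^ 2)) ?_
  filter_upwards [hpen, eventually_gt_atTop 0] with n hpenn hn
  rw [Real.norm_of_nonneg (integral_nonneg fun ω => sq_nonneg _),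
    Real.norm_of_nonneg (by positivity), Real.rpow_neg (by positivity), ← Real.sqrt_eq_rpow]
  refine (SigReg.integral_predictionGap_mHat_sq_le hd hX hY hident hindep hfresh hB0 hB hβstar hα
    hgap hKpen hn hpenn (hβhat n)).trans_eq ?_
  rw [← div_eq_mul_inv, mul_div_assoc]

theorem corollary1 {Ω : Type*} [MeasurableSpace Ω] (P : Measure Ω) [IsProbabilityMeasure P]
    {d : ℕ} (hd : 1 ≤ d)
    -- the generic pair and the observations
    (X : Ω → SigReg.BVPath d) (Y : Ω → ℝ) (Xs : ℕ → Ω → SigReg.BVPath d) (Ys : ℕ → Ω → ℝ)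
    (hX : Measurable X) (hY : Measurable Y)
    (hXs : ∀ i, Measurable (Xs i)) (hYs : ∀ i, Measurable (Ys i))
    -- the observations are i.i.d. copies of the generic pair, which is independent of them
    (hident : ∀ i, IdentDistrib (fun ω => (Xs i ω, Ys i ω)) (fun ω => (X ω, Y ω)) P P)
    (hindep : iIndepFun (fun i ω => (Xs i ω, Ys i ω)) P)
    (hfresh : IndepFun (fun ω => (X ω, Y ω)) (fun ω i => (Xs i ω, Ys i ω)) P)
    -- the signature linear model, with minimal truncation order `mstar`
    (mstar : ℕ) (hmstar : IsLeast {m | ∃ β, SigReg.IsRegression P X Y m β} mstar)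
    (βstar : SigReg.Coeff d mstar) (hβstar : SigReg.IsRegression P X Y mstar βstar)
    -- assumption `(H_α)`
    (α : ℝ) (hα : 0 < α) (hHα : ‖βstar‖ ≤ α)
    -- assumption `(H_K)`
    (KY KX : ℝ) (hKY : 0 < KY) (hKX : 0 < KX)
    (hHK : ∀ᵐ ω ∂P, |Y ω| ≤ KY ∧ (X ω).tv ≤ ENNReal.ofReal KX)
    -- the penalty parameters
    (Kpen ρ : ℝ) (hKpen : 0 < Kpen) (hρ : 0 < ρ) (hρ' : ρ < 1 / 2)
    -- the empirical risk minimizers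
    (βhat : ∀ n m : ℕ, SigReg.Sample d n → SigReg.Coeff d m)
    (hβhat : ∀ n m, SigReg.IsERM α (βhat n m)) :
    let D : (n : ℕ) → Ω → SigReg.Sample d n := fun n ω i => (Xs i ω, Ys i ω)
    let mhat : ℕ → Ω → ℕ := fun n ω => SigReg.mHat α Kpen ρ (D n ω)
    let err : ℕ → Ω → ℝ := fun n ω =>
      inner ℝ (βhat n (mhat n ω) (D n ω)) (SigReg.truncSig (mhat n ω) (X ω)) -
        inner ℝ βstar (SigReg.truncSig mstar (X ω))
    (∀ n, Integrable (fun ω => err n ω ^ 2) P) ∧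
      (fun n => ∫ ω, err n ω ^ 2 ∂P) =O[atTop] (fun n : ℕ => (n : ℝ) ^ (-(1 / 2) : ℝ)) := by
  exact corollary1_general P hd X Y Xs Ys hX (.of_bound hY.aestronglyMeasurable KY
      (hHK.mono fun _ h => h.1)) hident (fun _ _ => hindep.indepFun) hfresh α mstar
    (fun m hm β _ hβ => (hmstar.2 ⟨β, hβ⟩).not_gt hm) βstar hβstar hHα KX.toNNReal
    (hHK.mono fun _ h => h.2) Kpen ρ hKpen hρ βhat hβhat
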